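/- Let $\Bbbk=\mathbb R$ or $\mathbb C$, let $M$ be a smooth manifold (finite-dimensional, Hausdorff, $\sigma$-compact, without boundary) and $A=C^\infty(M)$ its algebra of smooth $\Bbbk$-valued functions. Let $\mathfrak g$ be one of the deformation differential graded Lie algebras $\mathcal T_{poly}[1](M)$ (polyvector fields, i.e. skew-symmetric multiderivations of $A$, with zero differential and the Schouten bracket), $\mathcal D_{poly}[1](M)$ (polydifferential operators on $A$, with the Gerstenhaber bracket and the Hochschild differential $d=[\mu,\cdot\,]$, $\mu$ the product of $A$), $\mathcal T_{poly}[1](M)[[\hbar]]$ or $\mathcal D_{poly}[1](M)[[\hbar]]$ (with the $\hbar$-linearly extended operations). In all of them, cochains of arity $n$ have degree $n-1$. An $L_\infty$-derivation $\mathscr X=\{X_n\}_{n\ge1}$ of $\mathfrak g$ is a coderivation of degree $0$ of the cofree graded cocommutative coalgebra $\Lambda(\mathfrak g[1])$, with Taylor coefficients $X_n:\Lambda^n(\mathfrak g[1])\to\mathfrak g[1]$, which commutes with the codifferential $D$ whose Taylor coefficients are $D_1=d$, $D_2(a,b)=(-1)^{|a|-1}[a,b]$, $D_n=0$ for $n\ge3$.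 Let $\pi\in\mathfrak g^1$ be a Maurer–Cartan element, $d\pi+\frac12[\pi,\pi]=0$, and let $d_\pi a=da+[\pi,a]$. Put $$\mathscr X(\pi)=\sum_{n\ge1}\frac1{n!}X_n(\pi,\dots,\pi),\qquad \mathscr X_{\pi,n}(a_1,\dots,a_n)=\sum_{p\ge0}\frac1{p!}X_{n+p}(a_1,\dots,a_n,\underbrace{\pi,\dots,\pi}_{p}).$$ Assume that all these series converge, where convergence is understood degree by degree, with respect to any fixed Hausdorff group topologies on the graded components of $\mathfrak g$ for which $d$ and all the maps $[x,\cdot\,]$ are continuous (e.g. the discrete, the $\hbar$-adic, or a $C^\infty$-type topology). Suppose that $\mathscr X$ satisfies the strong Nijenhuis condition with respect to $\pi$: $$\mathscr X_{\pi,n}(a_1,\dots,a_n)=0\quad\text{whenever } n\ge1 \text{ and } a_i=\mathscr X(\pi)\text{ for some } i.$$ Then for all $f,g\in\mathfrak g^{-1}$ with $d_\pi f=0=d_\pi g$ and all $k,l=0,1,2,\dots$ the elements $\mathscr X_{\pi,1}^k(f)$ and $\mathscr X_{\pi,1}^l(g)$ commute with respect to $\pi$: $$\{\mathscr X_{\pi,1}^k(f),\mathscr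 X_{\pi,1}^l(g)\}=[\mathscr X_{\pi,1}^k(f),[\pi,\mathscr X_{\pi,1}^l(g)]]=0.$$ -/

import Mathlib

open Function Finset Filter Topology Manifold
open scoped BigOperators Nat ContDiff DirectSum

noncomputable section

namespace DeformationTheory

section Arguments

variable {A : Type*}

/-- For `p + q = r + 1`, the `p` arguments
`v₀, …, v_{i-1}, Q(v_i, …, v_{i+q-1}), v_{i+q}, …, v_{r-1}`. -/
def insertArgs {p q r : ℕ} (h : p + q = r + 1) (i : Fin p) (Q : (Fin q → A) → A)
    (v : Fin r → A) : Fin p → A := fun j =>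
  if hj : j < i then v ⟨j, by have := i.isLt; have := Fin.lt_def.1 hj; omega⟩
  else if hj' : i < j then
    v ⟨j + q - 1, by have := j.isLt; have := Fin.lt_def.1 hj'; omega⟩
  else Q (fun t : Fin q => v ⟨i + t, by have := i.isLt; have := t.isLt; omega⟩)

theorem insertArgs_update_outer {p q r : ℕ} (h : p + q = r + 1) (i : Fin p)
    (m : Fin r) (hm : ¬ ((i : ℕ) ≤ m ∧ (m : ℕ) < i + q)) :
    ∃ j : Fin p, j ≠ i ∧ ∀ (Q : (Fin q → A) → A) (v : Fin r → A) (x : A),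
      insertArgs h i Q (update v m x) = update (insertArgs h i Q v) j x := by
  have hi := i.isLt
  have hm' := m.isLt
  have hblock : ∀ (v : Fin r → A) (x : A),
      (fun t : Fin q => update v m x ⟨i + t, by have := t.isLt; omega⟩) =
      (fun t : Fin q => v ⟨i + t, by have := t.isLt; omega⟩) := by
    intro v x
    funext t
    have := t.isLt
    rw [update_of_ne]
    intro e
    have := congrArg Fin.val e
    simp only at this
    omega
  by_cases hmi : (m : ℕ) < i
  · refine ⟨⟨m, by omega⟩, ?_, ?_⟩
    · intro e; have := congrArg Fin.val e; simp only at this; omega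
    · intro Q v x
      funext j
      by_cases hj : j = ⟨m, by omega⟩
      · subst hj
        rw [update_self]
        have : (⟨m, by omega⟩ : Fin p) < i := Fin.lt_def.2 hmi
        simp [insertArgs, this]
      · rw [update_of_ne hj]
        have hj' : (j : ℕ) ≠ m := fun e => hj (Fin.ext e)
        unfold insertArgs
        split_ifs with h1 h2
        · rw [update_of_ne]; intro e; exact hj' (congrArg Fin.val e)
        · rw [update_of_ne]; intro e; have := congrArg Fin.val e
          have := Fin.lt_def.1 h2; simp only at *; omega
        · rw [hblock]
  · refine ⟨⟨m + 1 - q, by omega⟩, ?_, ?_⟩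
    · intro e; have := congrArg Fin.val e; simp only at this; omega
    · intro Q v x
      funext j
      by_cases hj : j = ⟨m + 1 - q, by omega⟩
      · subst hj
        rw [update_self]
        have h1 : ¬ (⟨m + 1 - q, by omega⟩ : Fin p) < i := by rw [Fin.lt_def]; simp only; omega
        have h2 : i < (⟨m + 1 - q, by omega⟩ : Fin p) := by rw [Fin.lt_def]; simp only; omega
        unfold insertArgs
        rw [dif_neg h1, dif_pos h2]
        have : (⟨m + 1 - q + q - 1, by omega⟩ : Fin r) = m := Fin.ext (by simp only; omega)
        simp only [this, update_self]
      · rw [update_of_ne hj]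
        have hj' : (j : ℕ) ≠ m + 1 - q := fun e => hj (Fin.ext e)
        unfold insertArgs
        split_ifs with h1 h2
        · rw [update_of_ne]; intro e; have := congrArg Fin.val e
          have := Fin.lt_def.1 h1; simp only at *; omega
        · rw [update_of_ne]; intro e; have := congrArg Fin.val e
          have := Fin.lt_def.1 h2; simp only at *; omega
        · rw [hblock]

theorem insertArgs_update_inner {p q r : ℕ} (h : p + q = r + 1) (i : Fin p)
    (m : Fin r) (hm : (i : ℕ) ≤ m ∧ (m : ℕ) < i + q) :
    ∃ t : Fin q, (m : ℕ) = i + t ∧ ∀ (Q : (Fin q → A) → A) (v : Fin r → A) (x : A),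
      insertArgs h i Q (update v m x) = update (insertArgs h i Q v) i
        (Q (update (fun t : Fin q => v ⟨i + t, by have := i.isLt; have := t.isLt; omega⟩) t x)) := by
  have hi := i.isLt
  have hm' := m.isLt
  refine ⟨⟨m - i, by omega⟩, by simp only; omega, ?_⟩
  intro Q v x
  funext j
  by_cases hj : j = i
  · subst hj
    rw [update_self]
    unfold insertArgs
    rw [dif_neg (lt_irrefl _), dif_neg (lt_irrefl _)]
    congr 1
    funext t
    by_cases ht : t = ⟨m - j, by omega⟩
    · subst ht
      have : (⟨j + (m - j), by omega⟩ : Fin r) = m := Fin.ext (by simp only; omega)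
      simp only [this, update_self]
    · rw [update_of_ne ht, update_of_ne]
      intro e
      apply ht
      apply Fin.ext
      have := congrArg Fin.val e
      simp only at *
      omega
  · rw [update_of_ne hj]
    have hj' : (j : ℕ) ≠ i := fun e => hj (Fin.ext e)
    unfold insertArgs
    split_ifs with h1 h2
    · rw [update_of_ne]; intro e; have := congrArg Fin.val e
      have := Fin.lt_def.1 h1; simp only at *; omega
    · rw [update_of_ne]; intro e; have := congrArg Fin.val e
      have := Fin.lt_def.1 h2; simp only at *; omega
    · rw [Fin.lt_def] at h1 h2; omega

end Arguments

section Cochains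

variable {𝕜 A : Type*} [Field 𝕜] [CommRing A] [Algebra 𝕜 A]

/-- The partial composition
`(P ∘ᵢ Q)(v₀, …, v_{r-1}) = P(v₀, …, v_{i-1}, Q(v_i, …, v_{i+q-1}), v_{i+q}, …, v_{r-1})`. -/
def insertAt {p q r : ℕ} (h : p + q = r + 1) (i : Fin p)
    (P : MultilinearMap 𝕜 (fun _ : Fin p => A) A) (Q : MultilinearMap 𝕜 (fun _ : Fin q => A) A) :
    MultilinearMap 𝕜 (fun _ : Fin r => A) A where
  toFun v := P (insertArgs h i Q v)
  map_update_add' := by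
    intro inst v m x y
    rw [Subsingleton.elim inst (instDecidableEqFin r)]
    by_cases hm : (i : ℕ) ≤ m ∧ (m : ℕ) < i + q
    · obtain ⟨t, -, ht⟩ := insertArgs_update_inner (A := A) h i m hm
      simp only [ht, MultilinearMap.map_update_add]
    · obtain ⟨j, -, hj⟩ := insertArgs_update_outer (A := A) h i m hm
      simp only [hj, MultilinearMap.map_update_add]
  map_update_smul' := by
    intro inst v m c x
    rw [Subsingleton.elim inst (instDecidableEqFin r)]
    by_cases hm : (i : ℕ) ≤ m ∧ (m : ℕ) < i + q
    · obtain ⟨t, -, ht⟩ := insertArgs_update_inner (A := A) h i m hm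
      simp only [ht, MultilinearMap.map_update_smul]
    · obtain ⟨j, -, hj⟩ := insertArgs_update_outer (A := A) h i m hm
      simp only [hj, MultilinearMap.map_update_smul]

theorem insertArgs_eq_update {p q r : ℕ} (h : p + q = r + 1) (i : Fin p)
    (Q : (Fin q → A) → A) (v : Fin r → A) :
    insertArgs h i Q v = update (insertArgs h i 0 v) i
      (Q (fun t : Fin q => v ⟨i + t, by have := i.isLt; have := t.isLt; omega⟩)) := by
  funext j
  by_cases hj : j = i
  · subst hj
    simp [insertArgs]
  · rw [update_of_ne hj]
    have hj' : (j : ℕ) ≠ i := fun e => hj (Fin.ext e)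
    unfold insertArgs
    split_ifs with h1 h2
    · rfl
    · rfl
    · rw [Fin.lt_def] at h1 h2; omega

theorem insertAt_add_left {p q r : ℕ} (h : p + q = r + 1) (i : Fin p)
    (P P' : MultilinearMap 𝕜 (fun _ : Fin p => A) A)
    (Q : MultilinearMap 𝕜 (fun _ : Fin q => A) A) :
    insertAt h i (P + P') Q = insertAt h i P Q + insertAt h i P' Q := rfl

theorem insertAt_smul_left {p q r : ℕ} (h : p + q = r + 1) (i : Fin p) (c : 𝕜)
    (P : MultilinearMap 𝕜 (fun _ : Fin p => A) A)
    (Q : MultilinearMap 𝕜 (fun _ : Fin q => A) A) :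
    insertAt h i (c • P) Q = c • insertAt h i P Q := rfl

theorem insertAt_add_right {p q r : ℕ} (h : p + q = r + 1) (i : Fin p)
    (P : MultilinearMap 𝕜 (fun _ : Fin p => A) A)
    (Q Q' : MultilinearMap 𝕜 (fun _ : Fin q => A) A) :
    insertAt h i P (Q + Q') = insertAt h i P Q + insertAt h i P Q' := by
  ext v
  change P (insertArgs h i _ v) = P (insertArgs h i _ v) + P (insertArgs h i _ v)
  rw [insertArgs_eq_update, insertArgs_eq_update h i Q, insertArgs_eq_update h i Q',
    add_apply, MultilinearMap.map_update_add]

theorem insertAt_smul_right {p q r : ℕ} (h : p + q = r + 1) (i : Fin p) (c : 𝕜)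
    (P : MultilinearMap 𝕜 (fun _ : Fin p => A) A)
    (Q : MultilinearMap 𝕜 (fun _ : Fin q => A) A) :
    insertAt h i P (c • Q) = c • insertAt h i P Q := by
  ext v
  change P (insertArgs h i _ v) = c • P (insertArgs h i _ v)
  rw [insertArgs_eq_update, insertArgs_eq_update h i Q,
    smul_apply, MultilinearMap.map_update_smul]

end Cochains

section Polydifferential

variable {𝕜 A : Type*} [Field 𝕜] [CommRing A] [Algebra 𝕜 A]

/-- `IsDiffOp k D`: the linear map `D` is a differential operator of order `< k` on the
commutative algebra `A`, in the sense of iterated commutators with multiplication operators. -/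
def IsDiffOp : ℕ → (A →ₗ[𝕜] A) → Prop
  | 0, D => D = 0
  | k + 1, D => ∀ a : A,
      IsDiffOp k (D ∘ₗ LinearMap.mulLeft 𝕜 a - LinearMap.mulLeft 𝕜 a ∘ₗ D)

theorem IsDiffOp.zero (k : ℕ) : IsDiffOp k (0 : A →ₗ[𝕜] A) := by
  induction k with
  | zero => rfl
  | succ k ih => intro a; simpa using ih

theorem IsDiffOp.add {k : ℕ} {D E : A →ₗ[𝕜] A} (hD : IsDiffOp k D) (hE : IsDiffOp k E) :
    IsDiffOp k (D + E) := by
  induction k generalizing D E with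
  | zero => change D + E = 0; rw [show D = 0 from hD, show E = 0 from hE, add_zero]
  | succ k ih =>
    intro a
    rw [LinearMap.add_comp, LinearMap.comp_add, add_sub_add_comm]
    exact ih (hD a) (hE a)

theorem IsDiffOp.smul {k : ℕ} (c : 𝕜) {D : A →ₗ[𝕜] A} (hD : IsDiffOp k D) :
    IsDiffOp k (c • D) := by
  induction k generalizing D with
  | zero => change c • D = 0; rw [show D = 0 from hD, smul_zero]
  | succ k ih =>
    intro a
    convert ih (hD a) using 1
    ext x
    simp [smul_sub]

theorem IsDiffOp.succ {k : ℕ} {D : A →ₗ[𝕜] A} (hD : IsDiffOp k D) : IsDiffOp (k + 1) D := by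
  induction k generalizing D with
  | zero => rw [show D = 0 from hD]; exact IsDiffOp.zero 1
  | succ k ih => intro a; exact ih (hD a)

theorem IsDiffOp.mono {k l : ℕ} (h : k ≤ l) {D : A →ₗ[𝕜] A} (hD : IsDiffOp k D) :
    IsDiffOp l D := by
  induction l, h using Nat.le_induction with
  | base => exact hD
  | succ l _ ih => exact ih.succ

theorem IsDiffOp.comp {k l : ℕ} {D E : A →ₗ[𝕜] A} (hD : IsDiffOp k D) (hE : IsDiffOp l E) :
    IsDiffOp (k + l) (D ∘ₗ E) := by
  induction hn : k + l generalizing k l D E with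
  | zero =>
    obtain ⟨rfl, rfl⟩ : k = 0 ∧ l = 0 := by omega
    change D ∘ₗ E = 0
    rw [show D = 0 from hD, LinearMap.zero_comp]
  | succ n ih =>
    rcases k with _ | k
    · rw [show D = 0 from hD, LinearMap.zero_comp]; exact IsDiffOp.zero _
    rcases l with _ | l
    · rw [show E = 0 from hE, LinearMap.comp_zero]; exact IsDiffOp.zero _
    intro a
    have h1 := ih hD (hE a) (by omega)
    have h2 := ih (hD a) hE (by omega)
    convert h1.add h2 using 1
    ext x
    simp

variable (𝕜 A) in
/-- Polydifferential operators of arity `n`: multilinear maps `Aⁿ → A` which are differential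
operators of some bounded order in each argument. -/
def polydiffOp (n : ℕ) : Submodule 𝕜 (MultilinearMap 𝕜 (fun _ : Fin n => A) A) where
  carrier := {P | ∃ k : ℕ, ∀ (v : Fin n → A) (i : Fin n), IsDiffOp k (P.toLinearMap v i)}
  add_mem' := by
    rintro P Q ⟨k, hk⟩ ⟨l, hl⟩
    refine ⟨max k l, fun v i => ?_⟩
    exact ((hk v i).mono (le_max_left _ _)).add ((hl v i).mono (le_max_right _ _))
  zero_mem' := ⟨0, fun _ _ => rfl⟩
  smul_mem' := by
    rintro c P ⟨k, hk⟩
    exact ⟨k, fun v i => (hk v i).smul c⟩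

instance (n : ℕ) : AddCommGroup (polydiffOp 𝕜 A n) := Submodule.addCommGroup _

instance (n : ℕ) : Module 𝕜 (polydiffOp 𝕜 A n) := Submodule.module _

theorem insertAt_mem_polydiffOp {p q r : ℕ} (h : p + q = r + 1) (i : Fin p)
    {P : MultilinearMap 𝕜 (fun _ : Fin p => A) A} {Q : MultilinearMap 𝕜 (fun _ : Fin q => A) A}
    (hP : P ∈ polydiffOp 𝕜 A p) (hQ : Q ∈ polydiffOp 𝕜 A q) :
    insertAt h i P Q ∈ polydiffOp 𝕜 A r := by
  obtain ⟨k, hk⟩ := hP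
  obtain ⟨l, hl⟩ := hQ
  refine ⟨k + l, fun v m => ?_⟩
  by_cases hm : (i : ℕ) ≤ m ∧ (m : ℕ) < i + q
  · obtain ⟨t, -, ht⟩ := insertArgs_update_inner (A := A) h i m hm
    convert (hk (insertArgs h i Q v) i).comp (hl _ t) using 1
    ext x
    change P (insertArgs h i Q (update v m x)) = _
    rw [ht]
    rfl
  · obtain ⟨j, -, hj⟩ := insertArgs_update_outer (A := A) h i m hm
    convert (hk (insertArgs h i Q v) j).mono (Nat.le_add_right k l) using 1
    ext x
    change P (insertArgs h i Q (update v m x)) = _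
    rw [hj]
    rfl

/-- The Gerstenhaber product `P ∘ Q = ∑ᵢ (-1)^{i(q-1)} P ∘ᵢ Q`, as a bilinear map on
polydifferential operators. -/
def gerstenhaberProd {p q r : ℕ} (h : p + q = r + 1) :
    polydiffOp 𝕜 A p →ₗ[𝕜] polydiffOp 𝕜 A q →ₗ[𝕜] polydiffOp 𝕜 A r :=
  LinearMap.mk₂ 𝕜
    (fun P Q => ∑ i : Fin p, (-1 : 𝕜) ^ ((i : ℕ) * (q + 1)) •
      (⟨insertAt h i P Q, insertAt_mem_polydiffOp h i P.2 Q.2⟩ : polydiffOp 𝕜 A r))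
    (fun P P' Q => by
      rw [← Finset.sum_add_distrib]
      refine Finset.sum_congr rfl fun i _ => ?_
      rw [← smul_add]
      congr 1)
    (fun c P Q => by
      rw [Finset.smul_sum]
      refine Finset.sum_congr rfl fun i _ => ?_
      rw [smul_comm]
      congr 1)
    (fun P Q Q' => by
      rw [← Finset.sum_add_distrib]
      refine Finset.sum_congr rfl fun i _ => ?_
      rw [← smul_add]
      congr 1
      exact Subtype.ext (insertAt_add_right h i _ _ _))
    (fun c P Q => by
      rw [Finset.smul_sum]
      refine Finset.sum_congr rfl fun i _ => ?_
      rw [smul_comm]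
      congr 1
      exact Subtype.ext (insertAt_smul_right h i c _ _))

/-- The Gerstenhaber bracket `[P, Q] = P ∘ Q - (-1)^{(p-1)(q-1)} Q ∘ P`. -/
def gerstenhaberBracket (p q r : ℕ) (h : p + q = r + 1) :
    polydiffOp 𝕜 A p →ₗ[𝕜] polydiffOp 𝕜 A q →ₗ[𝕜] polydiffOp 𝕜 A r :=
  gerstenhaberProd (𝕜 := 𝕜) (A := A) h - (-1 : 𝕜) ^ ((p + 1) * (q + 1)) •
    (gerstenhaberProd (𝕜 := 𝕜) (A := A) (by omega : q + p = r + 1)).flip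

variable (𝕜 A) in
/-- The multiplication `(a, b) ↦ a b` of `A` as a bidifferential operator. -/
def mulCochain : polydiffOp 𝕜 A 2 :=
  ⟨MultilinearMap.mkPiAlgebra 𝕜 (Fin 2) A, by
    refine ⟨1, fun v i => ?_⟩
    intro a
    change (_ : A →ₗ[𝕜] A) = 0
    ext x
    fin_cases i <;> simp [Fin.prod_univ_two] <;> ring⟩

variable (𝕜 A) in
/-- The Hochschild differential `d P = [μ, P]`, where `μ` is the multiplication of `A`. -/
def hochschildD (n : ℕ) : polydiffOp 𝕜 A n →ₗ[𝕜] polydiffOp 𝕜 A (n + 1) :=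
  gerstenhaberBracket (𝕜 := 𝕜) (A := A) 2 n (n + 1) (by omega) (mulCochain 𝕜 A)

end Polydifferential

section Multiderivations

variable {𝕜 A : Type*} [Field 𝕜] [CommRing A] [Algebra 𝕜 A]

variable (𝕜 A) in
/-- Skew-symmetric multiderivations of arity `n` of the algebra `A`. For the algebra of smooth
functions on a manifold these are the `n`-vector fields. -/
def multiderivation (n : ℕ) : Submodule 𝕜 (A [⋀^Fin n]→ₗ[𝕜] A) where
  carrier := {P | ∀ (v : Fin n → A) (i : Fin n) (a b : A),
    P (update v i (a * b)) = a * P (update v i b) + b * P (update v i a)}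
  add_mem' := by
    intro P Q hP hQ v i a b
    rw [AlternatingMap.add_apply, AlternatingMap.add_apply, AlternatingMap.add_apply, hP, hQ]
    ring
  zero_mem' := by intro v i a b; simp
  smul_mem' := by
    intro c P hP v i a b
    rw [AlternatingMap.smul_apply, AlternatingMap.smul_apply, AlternatingMap.smul_apply, hP,
      smul_add, mul_smul_comm, mul_smul_comm]

instance (n : ℕ) : AddCommGroup (multiderivation 𝕜 A n) := Submodule.addCommGroup _

instance (n : ℕ) : Module 𝕜 (multiderivation 𝕜 A n) := Submodule.module _

/-- The insertion product
`(P ∘ Q)(v₀, …, v_{r-1}) = ∑_σ sgn(σ) P(Q(v_{σ(0)}, …, v_{σ(q-1)}), v_{σ(q)}, …, v_{σ(r-1)})`,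
the sum being over `(q, p-1)`-shuffles; it is written as the sum over all permutations divided
by `q! (p-1)!`. -/
def skewProd {p q r : ℕ} (h : p + q = r + 1) (P : A [⋀^Fin p]→ₗ[𝕜] A) (Q : A [⋀^Fin q]→ₗ[𝕜] A) :
    A [⋀^Fin r]→ₗ[𝕜] A :=
  if hp : 0 < p then
    ((q ! : 𝕜) * ((p - 1)! : 𝕜))⁻¹ • MultilinearMap.alternatization
      (insertAt h ⟨0, hp⟩ P.toMultilinearMap Q.toMultilinearMap)
  else 0

theorem skewProd_add_left {p q r : ℕ} (h : p + q = r + 1) (P P' : A [⋀^Fin p]→ₗ[𝕜] A)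
    (Q : A [⋀^Fin q]→ₗ[𝕜] A) : skewProd h (P + P') Q = skewProd h P Q + skewProd h P' Q := by
  unfold skewProd
  split_ifs with hp
  · rw [← smul_add, ← map_add]
    rfl
  · simp

theorem skewProd_add_right {p q r : ℕ} (h : p + q = r + 1) (P : A [⋀^Fin p]→ₗ[𝕜] A)
    (Q Q' : A [⋀^Fin q]→ₗ[𝕜] A) : skewProd h P (Q + Q') = skewProd h P Q + skewProd h P Q' := by
  unfold skewProd
  split_ifs with hp
  · rw [← smul_add, ← map_add, ← insertAt_add_right]
    rfl
  · simp

theorem alternatization_smul {n : ℕ} (c : 𝕜) (F : MultilinearMap 𝕜 (fun _ : Fin n => A) A) :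
    MultilinearMap.alternatization (c • F) = c • MultilinearMap.alternatization F := by
  ext v
  rw [AlternatingMap.smul_apply, MultilinearMap.alternatization_apply,
    MultilinearMap.alternatization_apply, Finset.smul_sum]
  refine Finset.sum_congr rfl fun σ _ => ?_
  rw [smul_comm]
  rfl

theorem skewProd_smul_left {p q r : ℕ} (h : p + q = r + 1) (c : 𝕜) (P : A [⋀^Fin p]→ₗ[𝕜] A)
    (Q : A [⋀^Fin q]→ₗ[𝕜] A) : skewProd h (c • P) Q = c • skewProd h P Q := by
  unfold skewProd
  split_ifs with hp
  · rw [smul_comm, ← alternatization_smul c]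
    rfl
  · simp

theorem skewProd_smul_right {p q r : ℕ} (h : p + q = r + 1) (c : 𝕜) (P : A [⋀^Fin p]→ₗ[𝕜] A)
    (Q : A [⋀^Fin q]→ₗ[𝕜] A) : skewProd h P (c • Q) = c • skewProd h P Q := by
  unfold skewProd
  split_ifs with hp
  · rw [smul_comm, ← alternatization_smul c, ← insertAt_smul_right]
    rfl
  · simp

/-- The failure of `w ↦ P(Q(w₀, …, w_{q-1}), w_q, …)` to be a derivation in its argument `m`. -/
def skewDefect {p q r : ℕ} (h : p + 1 + q = r + 1) (P : A [⋀^Fin (p + 1)]→ₗ[𝕜] A)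
    (Q : A [⋀^Fin q]→ₗ[𝕜] A) (a b : A) (w : Fin r → A) (m : Fin r) : A :=
  if hm : (m : ℕ) < q then
    P (update (insertArgs h 0 0 w) 0 a) *
        Q (update (fun t : Fin q => w ⟨t, by have := t.isLt; omega⟩) ⟨m, hm⟩ b) +
      P (update (insertArgs h 0 0 w) 0 b) *
        Q (update (fun t : Fin q => w ⟨t, by have := t.isLt; omega⟩) ⟨m, hm⟩ a)
  else 0

theorem insertAt_leibniz {p q r : ℕ} (h : p + 1 + q = r + 1) {P : A [⋀^Fin (p + 1)]→ₗ[𝕜] A}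
    {Q : A [⋀^Fin q]→ₗ[𝕜] A} (hP : P ∈ multiderivation 𝕜 A (p + 1))
    (hQ : Q ∈ multiderivation 𝕜 A q) (a b : A) (w : Fin r → A) (m : Fin r) :
    insertAt h 0 P.toMultilinearMap Q.toMultilinearMap (update w m (a * b)) =
      a * insertAt h 0 P.toMultilinearMap Q.toMultilinearMap (update w m b) +
      b * insertAt h 0 P.toMultilinearMap Q.toMultilinearMap (update w m a) +
      skewDefect h P Q a b w m := by
  have key : ∀ x, insertAt h 0 P.toMultilinearMap Q.toMultilinearMap (update w m x) =
      P (insertArgs h 0 Q (update w m x)) := fun _ => rfl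
  by_cases hm : (m : ℕ) < q
  · obtain ⟨t, ht', ht⟩ := insertArgs_update_inner (A := A) h 0 m ⟨by simp, by simpa using hm⟩
    have hB : (fun t : Fin q => w ⟨((0 : Fin (p + 1)) : ℕ) + t, by
        have := t.isLt; simp only [Fin.val_zero]; omega⟩) =
        (fun t : Fin q => w ⟨t, by have := t.isLt; omega⟩) := by
      funext t
      congr 2
      simp
    have htm : (⟨m, hm⟩ : Fin q) = t := Fin.ext (by simpa using ht')
    simp only [key, ht, hB, skewDefect, dif_pos hm, htm]
    rw [hQ]
    generalize (fun t : Fin q => w ⟨t, by have := t.isLt; omega⟩) = B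
    have hW : ∀ x, update (insertArgs h 0 (⇑Q) w) 0 x = update (insertArgs h 0 0 w) 0 x := by
      intro x
      rw [insertArgs_eq_update, update_idem]
    simp only [hW]
    have hadd := P.map_update_add (insertArgs h 0 0 w) 0
    rw [hadd, hP, hP]
    ring
  · obtain ⟨j, -, hj⟩ := insertArgs_update_outer (A := A) h 0 m
      (by simpa using hm)
    simp only [key, hj, skewDefect, dif_neg hm, add_zero]
    exact hP _ _ _ _

theorem alternatization_leibniz {p q r : ℕ} (h : p + 1 + q = r + 1)
    {P : A [⋀^Fin (p + 1)]→ₗ[𝕜] A} {Q : A [⋀^Fin q]→ₗ[𝕜] A}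
    (hP : P ∈ multiderivation 𝕜 A (p + 1)) (hQ : Q ∈ multiderivation 𝕜 A q) (a b : A)
    (v : Fin r → A) (i : Fin r) :
    MultilinearMap.alternatization (insertAt h 0 P.toMultilinearMap Q.toMultilinearMap)
        (update v i (a * b)) =
      a * MultilinearMap.alternatization (insertAt h 0 P.toMultilinearMap Q.toMultilinearMap)
        (update v i b) +
      b * MultilinearMap.alternatization (insertAt h 0 P.toMultilinearMap Q.toMultilinearMap)
        (update v i a) +
      ∑ σ : Equiv.Perm (Fin r), Equiv.Perm.sign σ • skewDefect h P Q a b (v ∘ σ) (σ.symm i) := by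
  have hup : ∀ (σ : Equiv.Perm (Fin r)) (x : A),
      (fun k => update v i x (σ k)) = update (v ∘ σ) (σ.symm i) x := by
    intro σ x
    funext k
    by_cases hk : k = σ.symm i
    · subst hk; simp
    · rw [update_of_ne hk, update_of_ne]
      · rfl
      · intro e; apply hk; rw [← e]; simp
  simp only [MultilinearMap.alternatization_apply, MultilinearMap.domDomCongr_apply, hup,
    Finset.mul_sum, ← Finset.sum_add_distrib]
  refine Finset.sum_congr rfl fun σ _ => ?_
  rw [insertAt_leibniz h hP hQ, smul_add, smul_add, mul_smul_comm, mul_smul_comm]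

theorem skewDefect_swap {p q r : ℕ} (h : p + 1 + (q + 1) = r + 1 + 1)
    (P : A [⋀^Fin (p + 1)]→ₗ[𝕜] A) (Q : A [⋀^Fin (q + 1)]→ₗ[𝕜] A) (a b : A) (w : Fin (r + 1) → A)
    (m : Fin (r + 1)) (hm : (m : ℕ) < q + 1) :
    Equiv.Perm.sign (Equiv.swap 0 m) • skewDefect h P Q a b (w ∘ Equiv.swap 0 m) m =
      skewDefect h P Q a b w 0 := by
  by_cases hm0 : m = 0
  · subst hm0; simp
  have hW : insertArgs h 0 0 (w ∘ Equiv.swap 0 m) = insertArgs h 0 0 w := by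
    funext j
    unfold insertArgs
    split_ifs with h1 h2
    · exact absurd h1 (Fin.not_lt_zero _)
    · rw [Fin.lt_def, Fin.val_zero] at h2
      simp only [comp_apply]
      rw [Equiv.swap_apply_of_ne_of_ne]
      · intro e; have := congrArg Fin.val e; simp at this; omega
      · intro e; have := congrArg Fin.val e; simp at this; omega
    · rfl
  have hq : ∀ x, Q (update (fun t : Fin (q + 1) => (w ∘ Equiv.swap 0 m)
      ⟨t, by have := t.isLt; omega⟩) ⟨m, hm⟩ x) =
      - Q (update (fun t : Fin (q + 1) => w ⟨t, by have := t.isLt; omega⟩) 0 x) := by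
    intro x
    have hne : (0 : Fin (q + 1)) ≠ ⟨m, hm⟩ := by
      intro e; apply hm0; apply Fin.ext; have := congrArg Fin.val e; simpa using this.symm
    rw [← Q.map_swap _ hne]
    congr 1
    funext t
    rw [comp_apply]
    by_cases ht : t = ⟨m, hm⟩
    · subst ht; simp
    · rw [update_of_ne ht]
      by_cases ht0 : t = 0
      · subst ht0
        rw [Equiv.swap_apply_left, update_of_ne hne.symm, comp_apply]
        congr 1
      · rw [Equiv.swap_apply_of_ne_of_ne ht0 ht, update_of_ne ht0, comp_apply]
        congr 1
        apply Equiv.swap_apply_of_ne_of_ne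
        · intro e; apply ht0; apply Fin.ext; simpa using congrArg Fin.val e
        · intro e; apply ht; apply Fin.ext; simpa using congrArg Fin.val e
  have h0 : ((0 : Fin (r + 1)) : ℕ) < q + 1 := by simp
  unfold skewDefect
  rw [dif_pos hm, dif_pos h0, hW, hq, hq, Equiv.Perm.sign_swap (Ne.symm hm0), Units.neg_smul,
    one_smul]
  have e0 : (⟨((0 : Fin (r + 1)) : ℕ), h0⟩ : Fin (q + 1)) = 0 := rfl
  rw [e0]
  ring

/-- The contribution of the permutations `σ` with `σ(0) = i`. -/
def skewDefectSum {p q r : ℕ} (h : p + 1 + q = r + 1 + 1) (P : A [⋀^Fin (p + 1)]→ₗ[𝕜] A)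
    (Q : A [⋀^Fin q]→ₗ[𝕜] A) (a b : A) (v : Fin (r + 1) → A) (i : Fin (r + 1)) : A :=
  ∑ σ : Equiv.Perm (Fin (r + 1)),
    if σ 0 = i then Equiv.Perm.sign σ • skewDefect h P Q a b (v ∘ σ) 0 else 0

theorem sum_skewDefect {p q r : ℕ} (h : p + 1 + (q + 1) = r + 1 + 1)
    (P : A [⋀^Fin (p + 1)]→ₗ[𝕜] A) (Q : A [⋀^Fin (q + 1)]→ₗ[𝕜] A) (a b : A)
    (v : Fin (r + 1) → A) (i : Fin (r + 1)) :
    ∑ σ : Equiv.Perm (Fin (r + 1)),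
        Equiv.Perm.sign σ • skewDefect h P Q a b (v ∘ σ) (σ.symm i) =
      (q + 1) • skewDefectSum h P Q a b v i := by
  have h1 : ∀ σ : Equiv.Perm (Fin (r + 1)),
      Equiv.Perm.sign σ • skewDefect h P Q a b (v ∘ σ) (σ.symm i) =
      ∑ m : Fin (r + 1), if σ m = i then Equiv.Perm.sign σ • skewDefect h P Q a b (v ∘ σ) m
        else 0 := by
    intro σ
    rw [Finset.sum_eq_single (σ.symm i)]
    · simp
    · intro m _ hm
      rw [if_neg]
      intro e; apply hm; rw [← e]; simp
    · simp
  rw [Finset.sum_congr rfl fun σ _ => h1 σ, Finset.sum_comm]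
  have h2 : ∀ m : Fin (r + 1), (∑ σ : Equiv.Perm (Fin (r + 1)),
      if σ m = i then Equiv.Perm.sign σ • skewDefect h P Q a b (v ∘ σ) m else 0) =
      if (m : ℕ) < q + 1 then skewDefectSum h P Q a b v i else 0 := by
    intro m
    split_ifs with hm
    · unfold skewDefectSum
      refine Fintype.sum_equiv (Equiv.mulRight (Equiv.swap 0 m)) _ _ fun σ => ?_
      simp only [Equiv.coe_mulRight, Equiv.Perm.mul_apply, Equiv.swap_apply_left,
        Equiv.Perm.sign_mul]
      split_ifs with hσ
      · rw [← skewDefect_swap h P Q a b (v ∘ ⇑(σ * Equiv.swap 0 m)) m hm]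
        have : (v ∘ ⇑(σ * Equiv.swap 0 m)) ∘ ⇑(Equiv.swap 0 m) = v ∘ σ := by
          funext k; simp
        rw [this, smul_smul, mul_assoc, Int.units_mul_self, mul_one]
      · rfl
    · refine Finset.sum_eq_zero fun σ _ => ?_
      split_ifs
      · unfold skewDefect; rw [dif_neg hm, smul_zero]
      · rfl
  rw [Finset.sum_congr rfl fun m _ => h2 m, ← Finset.sum_filter, Finset.sum_const,
    Fin.card_filter_val_lt, min_eq_right (by omega)]

theorem val_finRotate_pow {m : ℕ} (k : ℕ) (i : Fin m) :
    (((finRotate m) ^ k) i : ℕ) = (i + k) % m := by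
  induction k with
  | zero => simp [Nat.mod_eq_of_lt i.isLt]
  | succ k ih =>
    rcases m with _ | m
    · exact i.elim0
    rw [pow_succ', Equiv.Perm.mul_apply, coe_finRotate]
    have hlt := ((finRotate (m + 1) ^ k) i).isLt
    split_ifs with hl
    · have := congrArg Fin.val hl
      rw [ih, Fin.val_last] at this
      rw [← add_assoc, Nat.add_mod, this]
      rcases m with _ | m
      · simp
      · simp
    · have : (((finRotate (m + 1) ^ k) i : Fin (m + 1)) : ℕ) ≠ m := fun e => hl (Fin.ext e)
      rw [ih] at this hlt
      have h2 : ((i + k) % (m + 1) + 1) % (m + 1) = (i + k) % (m + 1) + 1 :=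
        Nat.mod_eq_of_lt (by omega)
      rw [ih, ← add_assoc, ← h2, Nat.mod_add_mod]

theorem exists_blockPerm (p q : ℕ) : ∃ ρ : Equiv.Perm (Fin (p + q + 1)),
    Equiv.Perm.sign ρ = (-1) ^ (p * q) ∧ ρ 0 = 0 ∧
    (∀ j : Fin (p + q + 1), 0 < (j : ℕ) → (j : ℕ) ≤ p → (ρ j : ℕ) = j + q) ∧
    (∀ j : Fin (p + q + 1), p < (j : ℕ) → (ρ j : ℕ) = j - p) := by
  refine ⟨Equiv.Perm.decomposeFin.symm (0, (finRotate (p + q)) ^ q), ?_, ?_, ?_, ?_⟩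
  · rw [Equiv.Perm.decomposeFin.symm_sign, if_pos rfl, one_mul, map_pow, sign_finRotate, ← pow_mul]
    rcases q with _ | q
    · simp
    · rw [show (p + (q + 1) - 1) * (q + 1) = p * (q + 1) + q * (q + 1) by
        rw [← add_assoc, Nat.add_sub_cancel, add_mul], pow_add,
        (Nat.even_mul_succ_self q).neg_one_pow, mul_one]
  · simp
  · intro j hj hjp
    obtain ⟨k, rfl⟩ := Fin.exists_succ_eq.2 (fun e : j = 0 => by simp [e] at hj)
    rw [Equiv.Perm.decomposeFin_symm_apply_succ, Equiv.swap_self, Equiv.refl_apply, Fin.val_succ,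
      val_finRotate_pow, Fin.val_succ] at *
    rw [Nat.mod_eq_of_lt (by omega)]
    omega
  · intro j hj
    obtain ⟨k, rfl⟩ := Fin.exists_succ_eq.2 (fun e : j = 0 => by simp [e] at hj)
    have := k.isLt
    rw [Equiv.Perm.decomposeFin_symm_apply_succ, Equiv.swap_self, Equiv.refl_apply, Fin.val_succ,
      val_finRotate_pow, Fin.val_succ] at *
    rw [Nat.mod_eq_sub_mod (by omega), Nat.mod_eq_of_lt (by omega)]
    omega

theorem skewDefect_block {p q : ℕ} (h : p + 1 + (q + 1) = p + q + 1 + 1)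
    (h' : q + 1 + (p + 1) = p + q + 1 + 1)
    (P : A [⋀^Fin (p + 1)]→ₗ[𝕜] A) (Q : A [⋀^Fin (q + 1)]→ₗ[𝕜] A) (a b : A)
    (w : Fin (p + q + 1) → A) (ρ : Equiv.Perm (Fin (p + q + 1)))
    (h1 : ∀ j : Fin (p + q + 1), 0 < (j : ℕ) → (j : ℕ) ≤ p → (ρ j : ℕ) = j + q)
    (h2 : ∀ j : Fin (p + q + 1), p < (j : ℕ) → (ρ j : ℕ) = j - p) :
    skewDefect h' Q P a b (w ∘ ρ) 0 = skewDefect h P Q a b w 0 := by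
  have hQ : ∀ x, update (insertArgs h' 0 0 (w ∘ ρ)) 0 x =
      update (fun t : Fin (q + 1) => w ⟨t, by have := t.isLt; omega⟩) 0 x := by
    intro x
    funext j
    by_cases hj : j = 0
    · subst hj; simp
    · rw [update_of_ne hj, update_of_ne hj]
      have hj0 : 0 < (j : ℕ) := Nat.pos_of_ne_zero fun e => hj (Fin.ext e)
      unfold insertArgs
      rw [dif_neg (Fin.not_lt_zero _), dif_pos (Fin.lt_def.2 (by simpa using hj0)), comp_apply]
      congr 1
      apply Fin.ext
      rw [h2 _ (by simp only; omega)]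
      simp only
      omega
  have hP : ∀ x, update (fun t : Fin (p + 1) => (w ∘ ρ) ⟨t, by have := t.isLt; omega⟩) 0 x =
      update (insertArgs h 0 0 w) 0 x := by
    intro x
    funext j
    by_cases hj : j = 0
    · subst hj; simp
    · rw [update_of_ne hj, update_of_ne hj]
      have hj0 : 0 < (j : ℕ) := Nat.pos_of_ne_zero fun e => hj (Fin.ext e)
      have := j.isLt
      unfold insertArgs
      rw [dif_neg (Fin.not_lt_zero _), dif_pos (Fin.lt_def.2 (by simpa using hj0)), comp_apply]
      congr 1
      apply Fin.ext
      rw [h1 _ (by simp only; omega) (by simp only; omega)]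
      simp only
      omega
  have hp0 : ((0 : Fin (p + q + 1)) : ℕ) < p + 1 := by simp
  have hq0 : ((0 : Fin (p + q + 1)) : ℕ) < q + 1 := by simp
  have ep : (⟨((0 : Fin (p + q + 1)) : ℕ), hp0⟩ : Fin (p + 1)) = 0 := rfl
  have eq : (⟨((0 : Fin (p + q + 1)) : ℕ), hq0⟩ : Fin (q + 1)) = 0 := rfl
  unfold skewDefect
  rw [dif_pos hp0, dif_pos hq0, ep, eq, hQ, hQ, hP, hP]
  ring

theorem skewDefectSum_comm {p q : ℕ} (h : p + 1 + (q + 1) = p + q + 1 + 1)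
    (h' : q + 1 + (p + 1) = p + q + 1 + 1)
    (P : A [⋀^Fin (p + 1)]→ₗ[𝕜] A) (Q : A [⋀^Fin (q + 1)]→ₗ[𝕜] A) (a b : A)
    (v : Fin (p + q + 1) → A) (i : Fin (p + q + 1)) :
    skewDefectSum h P Q a b v i = (-1 : 𝕜) ^ (p * q) • skewDefectSum h' Q P a b v i := by
  obtain ⟨ρ, hs, h0, h1, h2⟩ := exists_blockPerm p q
  unfold skewDefectSum
  rw [Finset.smul_sum]
  refine Fintype.sum_equiv (Equiv.mulRight ρ) _ _ fun σ => ?_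
  simp only [Equiv.coe_mulRight, Equiv.Perm.mul_apply, h0, Equiv.Perm.sign_mul, hs]
  split_ifs with hσ
  · rw [show v ∘ ⇑(σ * ρ) = (v ∘ σ) ∘ ρ from rfl, skewDefect_block h h' P Q a b _ ρ h1 h2]
    rcases neg_one_pow_eq_or ℤˣ (p * q) with e | e <;>
      rcases Nat.even_or_odd (p * q) with e' | e' <;>
      simp [e'.neg_one_pow]
  · simp

variable [CharZero 𝕜]

theorem schouten_mem {p q r : ℕ} (h : p + q = r + 1) (h' : q + p = r + 1)
    {P : A [⋀^Fin p]→ₗ[𝕜] A} {Q : A [⋀^Fin q]→ₗ[𝕜] A}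
    (hP : P ∈ multiderivation 𝕜 A p) (hQ : Q ∈ multiderivation 𝕜 A q) :
    skewProd h P Q - (-1 : 𝕜) ^ ((p + 1) * (q + 1)) • skewProd h' Q P ∈
      multiderivation 𝕜 A r := by
  -- if one of the arities is zero there is nothing to cancel
  have hzero : ∀ {p r : ℕ} (h : p + 0 = r + 1) {P : A [⋀^Fin p]→ₗ[𝕜] A} {Q : A [⋀^Fin 0]→ₗ[𝕜] A},
      P ∈ multiderivation 𝕜 A p → Q ∈ multiderivation 𝕜 A 0 →
      skewProd h P Q ∈ multiderivation 𝕜 A r := by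
    intro p r h P Q hP hQ
    rcases p with _ | p
    · omega
    unfold skewProd
    rw [dif_pos (Nat.succ_pos p)]
    refine Submodule.smul_mem _ _ ?_
    intro v i a b
    refine (alternatization_leibniz h hP hQ a b v i).trans ?_
    simp [skewDefect]
  have hzero' : ∀ {q r : ℕ} (h : 0 + q = r + 1) (P : A [⋀^Fin 0]→ₗ[𝕜] A) (Q : A [⋀^Fin q]→ₗ[𝕜] A),
      skewProd h P Q = 0 := by
    intro q r h P Q
    unfold skewProd
    rw [dif_neg (lt_irrefl 0)]
  rcases p with _ | p
  · rw [hzero' h P Q]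
    exact Submodule.sub_mem _ (Submodule.zero_mem _) (Submodule.smul_mem _ _ (hzero h' hQ hP))
  rcases q with _ | q
  · rw [hzero' h' Q P]
    exact Submodule.sub_mem _ (hzero h hP hQ) (Submodule.smul_mem _ _ (Submodule.zero_mem _))
  obtain rfl : r = p + q + 1 := by omega
  intro v i a b
  have hPQ : ∀ w, skewProd h P Q w = (((q + 1)! : 𝕜) * (p ! : 𝕜))⁻¹ •
      MultilinearMap.alternatization (insertAt h 0 P.toMultilinearMap Q.toMultilinearMap) w :=
    fun w => rfl
  have hQP : ∀ w, skewProd h' Q P w = (((p + 1)! : 𝕜) * (q ! : 𝕜))⁻¹ •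
      MultilinearMap.alternatization (insertAt h' 0 Q.toMultilinearMap P.toMultilinearMap) w :=
    fun w => rfl
  simp only [AlternatingMap.sub_apply, AlternatingMap.smul_apply, hPQ, hQP]
  rw [alternatization_leibniz h hP hQ, alternatization_leibniz h' hQ hP, sum_skewDefect,
    sum_skewDefect, skewDefectSum_comm h h']
  have hp : (p ! : 𝕜) ≠ 0 := by exact_mod_cast Nat.factorial_ne_zero p
  have hq : (q ! : 𝕜) ≠ 0 := by exact_mod_cast Nat.factorial_ne_zero q
  have hp1 : ((p : 𝕜) + 1) ≠ 0 := by exact_mod_cast Nat.succ_ne_zero p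
  have hq1 : ((q : 𝕜) + 1) ≠ 0 := by exact_mod_cast Nat.succ_ne_zero q
  have hsign : (-1 : 𝕜) ^ ((p + 1 + 1) * (q + 1 + 1)) = (-1 : 𝕜) ^ (p * q) := by
    rw [show (p + 1 + 1) * (q + 1 + 1) = p * q + 2 * (p + q + 2) by ring, pow_add, pow_mul]
    simp
  rw [hsign]
  simp only [← Nat.cast_smul_eq_nsmul 𝕜, Nat.factorial_succ, Nat.cast_mul, Nat.cast_add,
    Nat.cast_one, smul_add, smul_smul, mul_sub, mul_smul_comm]
  have e1 : (((q : 𝕜) + 1) * (q ! : 𝕜) * (p ! : 𝕜))⁻¹ * (((q : 𝕜) + 1) * (-1) ^ (p * q)) =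
      (-1) ^ (p * q) * ((p ! : 𝕜) * (q ! : 𝕜))⁻¹ := by
    field_simp
  have e2 : (-1 : 𝕜) ^ (p * q) * ((((p : 𝕜) + 1) * (p ! : 𝕜) * (q ! : 𝕜))⁻¹ * ((p : 𝕜) + 1)) =
      (-1) ^ (p * q) * ((p ! : 𝕜) * (q ! : 𝕜))⁻¹ := by
    field_simp
  rw [e1, e2]
  abel

/-- The Schouten bracket `[P, Q] = P ∘ Q - (-1)^{(p-1)(q-1)} Q ∘ P` of multiderivations. -/
def schoutenBracket (p q r : ℕ) (h : p + q = r + 1) :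
    multiderivation 𝕜 A p →ₗ[𝕜] multiderivation 𝕜 A q →ₗ[𝕜] multiderivation 𝕜 A r :=
  LinearMap.mk₂ 𝕜
    (fun P Q => ⟨skewProd h P.1 Q.1 -
        (-1 : 𝕜) ^ ((p + 1) * (q + 1)) • skewProd (by omega : q + p = r + 1) Q.1 P.1,
      schouten_mem h _ P.2 Q.2⟩)
    (fun P P' Q => Subtype.ext (by
      simp only [Submodule.coe_add, skewProd_add_left, skewProd_add_right, smul_add]
      abel))
    (fun c P Q => Subtype.ext (by
      simp only [Submodule.coe_smul, skewProd_smul_left, skewProd_smul_right, smul_sub]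
      rw [smul_comm c]))
    (fun P Q Q' => Subtype.ext (by
      simp only [Submodule.coe_add, skewProd_add_left, skewProd_add_right, smul_add]
      abel))
    (fun c P Q => Subtype.ext (by
      simp only [Submodule.coe_smul, skewProd_smul_left, skewProd_smul_right, smul_sub]
      rw [smul_comm c]))

end Multiderivations
section Graded

/-- The underlying operations of a differential graded Lie algebra concentrated in degrees
`≥ -1`. The space `C n` is the component of degree `n - 1` (cochains of arity `n`). -/
structure GradedBracketComplex (𝕜 : Type*) [Field 𝕜] where
  C : ℕ → Type*
  [addCommGroup : ∀ n, AddCommGroup (C n)]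
  [module : ∀ n, Module 𝕜 (C n)]
  d : ∀ n, C n →ₗ[𝕜] C (n + 1)
  bracket : ∀ p q r, p + q = r + 1 → (C p →ₗ[𝕜] C q →ₗ[𝕜] C r)

attribute [instance] GradedBracketComplex.addCommGroup GradedBracketComplex.module

namespace GradedBracketComplex

variable {𝕜 : Type*} [Field 𝕜] (𝔤 : GradedBracketComplex 𝕜)

/-- The total space `⨁ₙ C n`. -/
abbrev Total := ⨁ n, 𝔤.C n

/-- The homogeneous elements of degree `k`. -/
def gr (k : ℤ) : Submodule 𝕜 𝔤.Total where
  carrier := {x | ∀ n : ℕ, (n : ℤ) - 1 ≠ k → x n = 0}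
  add_mem' := by
    intro x y hx hy n hn
    rw [DirectSum.add_apply, hx n hn, hy n hn, add_zero]
  zero_mem' := by intro n _; rfl
  smul_mem' := by
    intro c x hx n hn
    rw [DirectSum.smul_apply, hx n hn, smul_zero]

/-- The differential on the total space. -/
def diff : 𝔤.Total →ₗ[𝕜] 𝔤.Total :=
  DirectSum.toModule 𝕜 ℕ 𝔤.Total fun n => DirectSum.lof 𝕜 ℕ 𝔤.C (n + 1) ∘ₗ 𝔤.d n

/-- The bracket on the total space. Two elements of degree `-1` have bracket zero, since
there is no component of degree `-2`. -/
def br : 𝔤.Total →ₗ[𝕜] 𝔤.Total →ₗ[𝕜] 𝔤.Total :=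
  DirectSum.toModule 𝕜 ℕ _ fun p => LinearMap.flip <| DirectSum.toModule 𝕜 ℕ _ fun q =>
    LinearMap.flip <|
      if h : 1 ≤ p + q then
        (𝔤.bracket p q (p + q - 1) (by omega)).compr₂ (DirectSum.lof 𝕜 ℕ 𝔤.C (p + q - 1))
      else 0

/-- `π` is a Maurer–Cartan element: `π` has degree `1` and `dπ + ½ [π, π] = 0`. -/
def IsMaurerCartan (π : 𝔤.Total) : Prop :=
  π ∈ 𝔤.gr 1 ∧ 𝔤.diff π + (2 : 𝕜)⁻¹ • 𝔤.br π π = 0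

/-- The twisted differential `d_π a = da + [π, a]`. -/
def twistedDiff (π a : 𝔤.Total) : 𝔤.Total := 𝔤.diff a + 𝔤.br π a

/-- Convergence of a sequence in the total space, component by component. -/
def ConvergesTo [∀ n, TopologicalSpace (𝔤.C n)] (s : ℕ → 𝔤.Total) (x : 𝔤.Total) : Prop :=
  ∀ n, Tendsto (fun N => s N n) atTop (𝓝 (x n))

/-- An `L∞`-derivation (of degree `0`), given by its Taylor coefficients `Xₙ`. All signs are
the Koszul signs for the shifted grading of `𝔤[1]`, in which an element of degree `k` of `𝔤`
has degree `k - 1`. In this grading `Xₙ` is a graded symmetric map of degree `0`,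
and the codifferential `D` of the coalgebra `Λ(𝔤[1])` has the Taylor coefficients
`D₁ a = da`, `D₂(a, b) = (-1)^{|a|-1} [a, b]` and `Dₙ = 0` for `n ≥ 3`. The last field says that
the coderivation with the coefficients `Xₙ` commutes with `D`. -/
structure LInftyDerivation where
  coeff : ∀ n : ℕ, MultilinearMap 𝕜 (fun _ : Fin n => 𝔤.Total) 𝔤.Total
  coeff_zero : coeff 0 = 0
  coeff_mem : ∀ (n : ℕ) (k : Fin n → ℤ) (a : Fin n → 𝔤.Total), (∀ i, a i ∈ 𝔤.gr (k i)) →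
    coeff n a ∈ 𝔤.gr ((∑ i, (k i - 1)) + 1)
  coeff_swap : ∀ (n : ℕ) (k : Fin n → ℤ) (a : Fin n → 𝔤.Total), (∀ i, a i ∈ 𝔤.gr (k i)) →
    ∀ i j : Fin n, (i : ℕ) + 1 = j →
      coeff n (a ∘ Equiv.swap i j) = ((k i - 1) * (k j - 1)).negOnePow • coeff n a
  comm_codiff : ∀ (n : ℕ) (k : Fin (n + 1) → ℤ) (a : Fin (n + 1) → 𝔤.Total),
    (∀ i, a i ∈ 𝔤.gr (k i)) →
    𝔤.diff (coeff (n + 1) a) +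
      ∑ i, ((k i - 1) * ∑ j ∈ Finset.Ioi i, (k j - 1)).negOnePow •
        ((∑ j ∈ Finset.univ.erase i, (k j - 1)).negOnePow •
          𝔤.br (coeff n (i.removeNth a)) (a i)) =
    ∑ i, (∑ l ∈ Finset.Iio i, (k l - 1)).negOnePow •
        coeff (n + 1) (update a i (𝔤.diff (a i))) +
      ∑ i, ∑ j ∈ Finset.Ioi i,
        ((∑ l ∈ Finset.Iio i, (k l - 1)) +
            (k j - 1) * ∑ l ∈ Finset.Ioo i j, (k l - 1)).negOnePow •
          coeff n (j.removeNth (update a i ((k i - 1).negOnePow • 𝔤.br (a i) (a j))))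

namespace LInftyDerivation

variable {𝔤} (X : 𝔤.LInftyDerivation)

/-- The partial sums of `X_{π,n}(a₁, …, aₙ) = ∑_{p ≥ 0} (1/p!) X_{n+p}(a₁, …, aₙ, π, …, π)`. -/
def twistPartialSum (π : 𝔤.Total) (n : ℕ) (a : Fin n → 𝔤.Total) (N : ℕ) : 𝔤.Total :=
  ∑ p ∈ Finset.range N, ((p ! : 𝕜))⁻¹ • X.coeff (n + p) (Fin.append a fun _ : Fin p => π)

variable [∀ n, TopologicalSpace (𝔤.C n)]

/-- All the series `X_{π,n}(a₁, …, aₙ)` converge. -/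
def TwistConverges (π : 𝔤.Total) : Prop :=
  ∀ (n : ℕ) (a : Fin n → 𝔤.Total), ∃ x, 𝔤.ConvergesTo (X.twistPartialSum π n a) x

open Classical in
/-- The twisted Taylor coefficient `X_{π,n}(a₁, …, aₙ)`: the sum of the series if it converges. -/
def twisted (π : 𝔤.Total) (n : ℕ) (a : Fin n → 𝔤.Total) : 𝔤.Total :=
  if h : ∃ x, 𝔤.ConvergesTo (X.twistPartialSum π n a) x then h.choose else 0

/-- The element `X(π) = ∑_{n ≥ 1} (1/n!) Xₙ(π, …, π)`. -/
def atPoint (π : 𝔤.Total) : 𝔤.Total := X.twisted π 0 Fin.elim0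

/-- The operator `X_{π,1}`. -/
def twistedOne (π : 𝔤.Total) : 𝔤.Total → 𝔤.Total := fun a => X.twisted π 1 fun _ => a

/-- The strong Nijenhuis condition: `X_{π,n}(a₁, …, aₙ) = 0` as soon as some `aᵢ` is `X(π)`. -/
def StrongNijenhuis (π : 𝔤.Total) : Prop :=
  ∀ (n : ℕ) (a : Fin n → 𝔤.Total), (∃ i, a i = X.atPoint π) → X.twisted π n a = 0

end LInftyDerivation

/-- The algebra `𝔤[[ħ]]`: its elements of degree `n - 1` are the formal power series
`∑_N ħ^N x_N`, `x_N ∈ C n`, and the operations are extended `ħ`-linearly. -/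
def formal : GradedBracketComplex 𝕜 where
  C n := ℕ → 𝔤.C n
  d n := LinearMap.pi fun N => 𝔤.d n ∘ₗ LinearMap.proj N
  bracket p q r h := LinearMap.mk₂ 𝕜
    (fun x y N => ∑ ij ∈ Finset.HasAntidiagonal.antidiagonal N, 𝔤.bracket p q r h (x ij.1) (y ij.2))
    (fun x x' y => by funext N; simp [Finset.sum_add_distrib])
    (fun c x y => by funext N; simp [Finset.smul_sum])
    (fun x y y' => by funext N; simp [Finset.sum_add_distrib])
    (fun c x y => by funext N; simp [Finset.smul_sum])

end GradedBracketComplex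

end Graded

section Manifold

/-- The algebra `C^∞(M)` of smooth `𝕜`-valued functions on a manifold `M`, `𝕜 = ℝ` or `ℂ`. -/
def smoothFunctions (𝕜 : Type*) [RCLike 𝕜] (m : ℕ) (M : Type*) [TopologicalSpace M]
    [ChartedSpace (EuclideanSpace ℝ (Fin m)) M] : Subalgebra 𝕜 (M → 𝕜) where
  carrier := {f | ContMDiff (𝓡 m) 𝓘(ℝ, 𝕜) ∞ f}
  mul_mem' hf hg :=
    (contDiff_mul (𝕜 := ℝ) (𝔸 := 𝕜)).contMDiff.comp (ContMDiff.prodMk_space hf hg)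
  add_mem' hf hg := ContMDiff.add hf hg
  algebraMap_mem' _ := contMDiff_const

/-- Polyvector fields `𝒯_poly[1](M)` with zero differential and the Schouten bracket. -/
def Tpoly (𝕜 : Type*) [RCLike 𝕜] (m : ℕ) (M : Type*) [TopologicalSpace M]
    [ChartedSpace (EuclideanSpace ℝ (Fin m)) M] : GradedBracketComplex 𝕜 where
  C n := multiderivation 𝕜 (smoothFunctions 𝕜 m M) n
  d _ := 0
  bracket := schoutenBracket

/-- Polydifferential operators `𝒟_poly[1](M)` with the Hochschild differential and the
Gerstenhaber bracket. -/
def Dpoly (𝕜 : Type*) [RCLike 𝕜] (m : ℕ) (M : Type*) [TopologicalSpace M]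
    [ChartedSpace (EuclideanSpace ℝ (Fin m)) M] : GradedBracketComplex 𝕜 where
  C n := polydiffOp 𝕜 (smoothFunctions 𝕜 m M) n
  d := hochschildD 𝕜 (smoothFunctions 𝕜 m M)
  bracket := gerstenhaberBracket

/-- The deformation DG Lie algebras of `M`. -/
inductive IsDeformationAlgebra (𝕜 : Type*) [RCLike 𝕜] (m : ℕ) (M : Type*) [TopologicalSpace M]
    [ChartedSpace (EuclideanSpace ℝ (Fin m)) M] : GradedBracketComplex 𝕜 → Prop
  | tpoly : IsDeformationAlgebra 𝕜 m M (Tpoly 𝕜 m M)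
  | dpoly : IsDeformationAlgebra 𝕜 m M (Dpoly 𝕜 m M)
  | tpolyFormal : IsDeformationAlgebra 𝕜 m M (Tpoly 𝕜 m M).formal
  | dpolyFormal : IsDeformationAlgebra 𝕜 m M (Dpoly 𝕜 m M).formal

end Manifold

end DeformationTheory

end

/-!
The element `ν = X(π)` and the operator `X₁ = X_{π,1}` satisfy three identities, which are the
compatibility of the twisted coderivation with the twisted codifferential on zero, one and two
arguments: `d_π ν = 0`, `d_π X₁ a + [a, ν] = X₁ d_π a`, and, for the pair `a, ν`, the strong
Nijenhuis condition kills every term containing `X_{π,2}(·, ν)` or `X₁ ν`, the term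
`X_{π,2}(a, d_π ν)` vanishes by the first identity, and `X₁ [ν, a] = [ν, X₁ a]` remains. Hence
for `f` of degree `-1` with `d_π f = 0` the iterates `f_k = X₁ᵏ f` satisfy
`d_π f_k = -k [ν, f_{k-1}]`.

In degree `-1` the differential `d` vanishes, so `[π, g_l] = d_π g_l` and
`{f_k, g_l} = -l B(k, l - 1)` with `B(k, l) = [f_k, [ν, g_l]]`. For an element `x` of degree `1` the
derived bracket `[f, [x, g]]` on degree `-1` is antisymmetric. Computing `{f_k, g_{l+1}}` from both
sides therefore yields `(l + 1) B(k, l) = k B(k - 1, l + 1)`, and `B` vanishes by induction on `k`.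

The twisted identities are obtained by applying the compatibility of `X` with the codifferential
to the arguments `a₁, …, aₙ, π, …, π` for `n ≤ 2` and summing over the number of `π`
(`comm_codiff_nil`, `comm_codiff_singleton`, `comm_codiff_pair`). At most one argument of a Taylor
coefficient has even degree throughout, so all Koszul signs are trivial. About the deformation
algebras only `HasDerivedBracket` is used. Multiplication by scalars is not assumed
continuous; the factor `1 / 2` of the Maurer–Cartan equation is therefore kept inside the arguments.
-/

/-! ### The brackets in low arity -/

namespace DeformationTheory

namespace GradedBracketComplex

/-- The properties of the deformation algebras that the argument uses: the bracket is
symmetric on odd degrees, the differential vanishes in degree `-1`, and the derived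
bracket `[f, [x, g]]` of two elements of degree `-1` with respect to an element `x` of degree `1` is
antisymmetric. The last condition is the Jacobi identity together with `[f, g] = 0`. -/
structure HasDerivedBracket {𝕜 : Type*} [Field 𝕜] (𝔤 : GradedBracketComplex 𝕜) : Prop where
  bracket_symm : ∀ (p q r : ℕ) (h : p + q = r + 1) (h' : q + p = r + 1), Even p → Even q →
    ∀ (x : 𝔤.C p) (y : 𝔤.C q), 𝔤.bracket p q r h x y = 𝔤.bracket q p r h' y x
  d_zero : 𝔤.d 0 = 0
  derived_antisymm : ∀ (x : 𝔤.C 2) (f g : 𝔤.C 0),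
    𝔤.bracket 0 1 0 rfl f (𝔤.bracket 2 0 1 rfl x g) =
      - 𝔤.bracket 0 1 0 rfl g (𝔤.bracket 2 0 1 rfl x f)

theorem HasDerivedBracket.formal {𝕜 : Type*} [Field 𝕜] {𝔤 : GradedBracketComplex 𝕜}
    (H : 𝔤.HasDerivedBracket) : 𝔤.formal.HasDerivedBracket where
  bracket_symm p q r h h' hp hq x y := by
    funext N
    change ∑ ij ∈ antidiagonal N, 𝔤.bracket p q r h (x ij.1) (y ij.2) =
      ∑ ij ∈ antidiagonal N, 𝔤.bracket q p r h' (y ij.1) (x ij.2)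
    rw [← Finset.Nat.sum_antidiagonal_swap]
    exact Finset.sum_congr rfl fun ij _ => H.bracket_symm p q r h h' hp hq _ _
  d_zero := by
    ext x
    funext N
    change 𝔤.d 0 (x N) = 0
    rw [H.d_zero]
    rfl
  derived_antisymm x f g := by
    funext N
    change ∑ ij ∈ antidiagonal N, 𝔤.bracket 0 1 0 rfl (f ij.1)
        (∑ kl ∈ antidiagonal ij.2, 𝔤.bracket 2 0 1 rfl (x kl.1) (g kl.2)) =
      - ∑ ij ∈ antidiagonal N, 𝔤.bracket 0 1 0 rfl (g ij.1)
        (∑ kl ∈ antidiagonal ij.2, 𝔤.bracket 2 0 1 rfl (x kl.1) (f kl.2))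
    simp only [map_sum]
    rw [Finset.sum_sigma', Finset.sum_sigma', ← Finset.sum_neg_distrib]
    -- Exchange the powers of `ħ` at `f` and at `g`.
    refine Finset.sum_nbij' (fun s => ⟨(s.2.2, s.2.1 + s.1.1), (s.2.1, s.1.1)⟩)
      (fun s => ⟨(s.2.2, s.2.1 + s.1.1), (s.2.1, s.1.1)⟩) ?_ ?_ ?_ ?_ ?_
    · rintro ⟨⟨i, j⟩, ⟨k, l⟩⟩ hs
      simp only [mem_sigma, HasAntidiagonal.mem_antidiagonal] at hs ⊢
      obtain ⟨rfl, rfl⟩ := hs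
      exact ⟨by ac_rfl, trivial⟩
    · rintro ⟨⟨i, j⟩, ⟨k, l⟩⟩ hs
      simp only [mem_sigma, HasAntidiagonal.mem_antidiagonal] at hs ⊢
      obtain ⟨rfl, rfl⟩ := hs
      exact ⟨by ac_rfl, trivial⟩
    · rintro ⟨⟨i, j⟩, ⟨k, l⟩⟩ hs
      simp only [mem_sigma, HasAntidiagonal.mem_antidiagonal] at hs
      simp [hs.2]
    · rintro ⟨⟨i, j⟩, ⟨k, l⟩⟩ hs
      simp only [mem_sigma, HasAntidiagonal.mem_antidiagonal] at hs
      simp [hs.2]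
    · rintro ⟨⟨i, j⟩, ⟨k, l⟩⟩ -
      exact H.derived_antisymm _ _ _

end GradedBracketComplex

section Brackets

variable {𝕜 A : Type*} [Field 𝕜] [CommRing A] [Algebra 𝕜 A]

theorem neg_one_pow_succ_mul_succ {p q : ℕ} (hp : Even p) (hq : Even q) :
    (-1 : 𝕜) ^ ((p + 1) * (q + 1)) = -1 :=
  (hp.add_one.mul hq.add_one).neg_one_pow

theorem gerstenhaberBracket_symm {p q r : ℕ} (h : p + q = r + 1) (h' : q + p = r + 1)
    (hp : Even p) (hq : Even q) (P : polydiffOp 𝕜 A p) (Q : polydiffOp 𝕜 A q) :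
    gerstenhaberBracket p q r h P Q = gerstenhaberBracket q p r h' Q P := by
  simp only [gerstenhaberBracket, neg_one_pow_succ_mul_succ hp hq, neg_one_pow_succ_mul_succ hq hp,
    LinearMap.sub_apply, LinearMap.smul_apply, neg_smul, one_smul,
    sub_neg_eq_add]
  exact add_comm _ _

theorem gerstenhaberProd_apply {p q r : ℕ} (h : p + q = r + 1) (P : polydiffOp 𝕜 A p)
    (Q : polydiffOp 𝕜 A q) (v : Fin r → A) :
    (gerstenhaberProd h P Q).1 v =
      ∑ i : Fin p, (-1 : 𝕜) ^ ((i : ℕ) * (q + 1)) • P.1 (insertArgs h i Q.1 v) := by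
  simp [gerstenhaberProd, insertAt]

theorem gerstenhaberBracket_two_zero (P : polydiffOp 𝕜 A 2) (Q : polydiffOp 𝕜 A 0)
    (v : Fin 1 → A) :
    (gerstenhaberBracket 2 0 1 rfl P Q).1 v =
      P.1 ![Q.1 Fin.elim0, v 0] - P.1 ![v 0, Q.1 Fin.elim0] := by
  have h0 : insertArgs (A := A) (p := 2) (q := 0) (r := 1) rfl 0 Q.1 v =
      ![Q.1 Fin.elim0, v 0] := by
    funext j
    fin_cases j <;> simp [insertArgs, Subsingleton.elim _ (Fin.elim0 : Fin 0 → A)]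
  have h1 : insertArgs (A := A) (p := 2) (q := 0) (r := 1) rfl 1 Q.1 v =
      ![v 0, Q.1 Fin.elim0] := by
    funext j
    fin_cases j <;> simp [insertArgs, Subsingleton.elim _ (Fin.elim0 : Fin 0 → A)]
  simp [gerstenhaberBracket, gerstenhaberProd_apply, Fin.sum_univ_two, h0, h1, sub_eq_add_neg]

theorem gerstenhaberBracket_zero_one (Q : polydiffOp 𝕜 A 0) (P : polydiffOp 𝕜 A 1)
    (v : Fin 0 → A) :
    (gerstenhaberBracket 0 1 0 rfl Q P).1 v = - P.1 ![Q.1 Fin.elim0] := by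
  have h0 : insertArgs (A := A) (p := 1) (q := 0) (r := 0) rfl 0 Q.1 v =
      ![Q.1 Fin.elim0] := by
    funext j
    fin_cases j; simp [insertArgs, Subsingleton.elim _ (Fin.elim0 : Fin 0 → A)]
  simp [gerstenhaberBracket, gerstenhaberProd_apply, h0]

theorem hochschildD_zero : hochschildD 𝕜 A 0 = 0 := by
  ext P v
  refine (gerstenhaberBracket_two_zero (mulCochain 𝕜 A) P v).trans ?_
  simp [mulCochain, MultilinearMap.mkPiAlgebra_apply, Fin.prod_univ_two, mul_comm]

theorem gerstenhaberBracket_derived_antisymm (P : polydiffOp 𝕜 A 2) (f g : polydiffOp 𝕜 A 0) :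
    gerstenhaberBracket 0 1 0 rfl f (gerstenhaberBracket 2 0 1 rfl P g) =
      - gerstenhaberBracket 0 1 0 rfl g (gerstenhaberBracket 2 0 1 rfl P f) := by
  refine Subtype.ext (MultilinearMap.ext fun v => ?_)
  change (gerstenhaberBracket 0 1 0 rfl f (gerstenhaberBracket 2 0 1 rfl P g)).1 v =
      - (gerstenhaberBracket 0 1 0 rfl g (gerstenhaberBracket 2 0 1 rfl P f)).1 v
  simp [gerstenhaberBracket_zero_one, gerstenhaberBracket_two_zero]

variable [CharZero 𝕜]

theorem schoutenBracket_symm {p q r : ℕ} (h : p + q = r + 1) (h' : q + p = r + 1)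
    (hp : Even p) (hq : Even q) (P : multiderivation 𝕜 A p) (Q : multiderivation 𝕜 A q) :
    schoutenBracket p q r h P Q = schoutenBracket q p r h' Q P := by
  refine Subtype.ext ?_
  change skewProd h P.1 Q.1 - (-1 : 𝕜) ^ ((p + 1) * (q + 1)) • skewProd h' Q.1 P.1 =
    skewProd h' Q.1 P.1 - (-1 : 𝕜) ^ ((q + 1) * (p + 1)) • skewProd h P.1 Q.1
  rw [neg_one_pow_succ_mul_succ hp hq, neg_one_pow_succ_mul_succ hq hp]
  module

theorem schoutenBracket_two_zero (P : multiderivation 𝕜 A 2) (Q : multiderivation 𝕜 A 0)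
    (v : Fin 1 → A) :
    (schoutenBracket 2 0 1 rfl P Q).1 v = P.1 ![Q.1 Fin.elim0, v 0] := by
  have h0 : insertArgs (A := A) (p := 2) (q := 0) (r := 1) rfl 0 Q.1 v =
      ![Q.1 Fin.elim0, v 0] := by
    funext j
    fin_cases j <;> simp [insertArgs, Subsingleton.elim _ (Fin.elim0 : Fin 0 → A)]
  simp [schoutenBracket, skewProd, MultilinearMap.alternatization_apply, insertAt, h0]

theorem schoutenBracket_zero_one (Q : multiderivation 𝕜 A 0) (P : multiderivation 𝕜 A 1)
    (v : Fin 0 → A) :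
    (schoutenBracket 0 1 0 rfl Q P).1 v = - P.1 ![Q.1 Fin.elim0] := by
  have h0 : insertArgs (A := A) (p := 1) (q := 0) (r := 0) rfl 0 Q.1 v =
      ![Q.1 Fin.elim0] := by
    funext j
    fin_cases j; simp [insertArgs, Subsingleton.elim _ (Fin.elim0 : Fin 0 → A)]
  simp [schoutenBracket, skewProd, MultilinearMap.alternatization_apply, insertAt, h0]

theorem schoutenBracket_derived_antisymm (P : multiderivation 𝕜 A 2)
    (f g : multiderivation 𝕜 A 0) :
    schoutenBracket 0 1 0 rfl f (schoutenBracket 2 0 1 rfl P g) =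
      - schoutenBracket 0 1 0 rfl g (schoutenBracket 2 0 1 rfl P f) := by
  refine Subtype.ext (AlternatingMap.ext fun v => ?_)
  change (schoutenBracket 0 1 0 rfl f (schoutenBracket 2 0 1 rfl P g)).1 v =
      - (schoutenBracket 0 1 0 rfl g (schoutenBracket 2 0 1 rfl P f)).1 v
  rw [schoutenBracket_zero_one, schoutenBracket_zero_one, schoutenBracket_two_zero,
    schoutenBracket_two_zero, ← P.1.map_swap _ (zero_ne_one (α := Fin 2)), neg_neg]
  congr 1
  funext j
  fin_cases j <;> simp

end Brackets

theorem IsDeformationAlgebra.hasDerivedBracket {𝕜 : Type*} [RCLike 𝕜] {m : ℕ} {M : Type*}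
    [TopologicalSpace M] [ChartedSpace (EuclideanSpace ℝ (Fin m)) M]
    {𝔤 : GradedBracketComplex 𝕜} (h : IsDeformationAlgebra 𝕜 m M 𝔤) : 𝔤.HasDerivedBracket := by
  have hT : (Tpoly 𝕜 m M).HasDerivedBracket :=
    { bracket_symm := fun _ _ _ h h' hp hq P Q => schoutenBracket_symm h h' hp hq P Q
      d_zero := rfl
      derived_antisymm := schoutenBracket_derived_antisymm }
  have hD : (Dpoly 𝕜 m M).HasDerivedBracket :=
    { bracket_symm := fun _ _ _ h h' hp hq P Q => gerstenhaberBracket_symm h h' hp hq P Q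
      d_zero := hochschildD_zero
      derived_antisymm := gerstenhaberBracket_derived_antisymm }
  cases h with
  | tpoly => exact hT
  | dpoly => exact hD
  | tpolyFormal => exact hT.formal
  | dpolyFormal => exact hD.formal

end DeformationTheory

namespace DeformationTheory

namespace GradedBracketComplex

/-! ### Homogeneous elements of the total space -/

section Homogeneous

variable {𝕜 : Type*} [Field 𝕜] {𝔤 : GradedBracketComplex 𝕜}

theorem lof_mem_gr {n : ℕ} {k : ℤ} (h : (n : ℤ) - 1 = k) (x : 𝔤.C n) :
    DirectSum.lof 𝕜 ℕ 𝔤.C n x ∈ 𝔤.gr k := by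
  intro m hm
  exact DirectSum.of_eq_of_ne _ _ _ fun e => hm (by rw [e, h])

theorem eq_lof_of_mem_gr {x : 𝔤.Total} {k : ℤ} (hx : x ∈ 𝔤.gr k) {n : ℕ}
    (h : (n : ℤ) - 1 = k) : x = DirectSum.lof 𝕜 ℕ 𝔤.C n (x n) := by
  ext1 m
  by_cases hm : m = n
  · subst hm
    exact (DirectSum.lof_apply 𝕜 m (x m)).symm
  · rw [hx m (by omega), lof_mem_gr h _ m (by omega)]

theorem eq_zero_or_eq_lof_of_mem_gr {x : 𝔤.Total} {k : ℤ} (hx : x ∈ 𝔤.gr k) :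
    x = 0 ∨ ∃ n : ℕ, (n : ℤ) - 1 = k ∧ ∃ y, x = DirectSum.lof 𝕜 ℕ 𝔤.C n y := by
  by_cases h : ∃ n : ℕ, (n : ℤ) - 1 = k
  · obtain ⟨n, hn⟩ := h
    exact Or.inr ⟨n, hn, _, eq_lof_of_mem_gr hx hn⟩
  · push Not at h
    refine Or.inl ?_
    ext1 m
    exact hx m (h m)

theorem diff_lof (n : ℕ) (x : 𝔤.C n) :
    𝔤.diff (DirectSum.lof 𝕜 ℕ 𝔤.C n x) = DirectSum.lof 𝕜 ℕ 𝔤.C (n + 1) (𝔤.d n x) := by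
  simp [diff]

theorem br_lof {p q r : ℕ} (h : p + q = r + 1) (x : 𝔤.C p) (y : 𝔤.C q) :
    𝔤.br (DirectSum.lof 𝕜 ℕ 𝔤.C p x) (DirectSum.lof 𝕜 ℕ 𝔤.C q y) =
      DirectSum.lof 𝕜 ℕ 𝔤.C r (𝔤.bracket p q r h x y) := by
  obtain rfl : r = p + q - 1 := by omega
  simp [br, show 1 ≤ p + q by omega]

theorem br_lof_zero_zero (x y : 𝔤.C 0) :
    𝔤.br (DirectSum.lof 𝕜 ℕ 𝔤.C 0 x) (DirectSum.lof 𝕜 ℕ 𝔤.C 0 y) = 0 := by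
  simp [br]

theorem diff_apply_zero (x : 𝔤.Total) : 𝔤.diff x 0 = 0 := by
  induction x using DirectSum.induction_on with
  | zero => simp
  | of n x =>
    exact (congrArg (fun z : 𝔤.Total => z 0) (diff_lof n x)).trans
      (DirectSum.of_eq_of_ne _ _ _ (by omega))
  | add x y hx hy => rw [map_add, DirectSum.add_apply, hx, hy, add_zero]

theorem diff_apply_succ (x : 𝔤.Total) (n : ℕ) : 𝔤.diff x (n + 1) = 𝔤.d n (x n) := by
  induction x using DirectSum.induction_on with
  | zero => simp
  | of m x =>
    refine (congrArg (fun z : 𝔤.Total => z (n + 1)) (diff_lof m x)).trans ?_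
    by_cases h : n = m
    · subst h
      rw [DirectSum.lof_apply, DirectSum.of_eq_same]
    · rw [DirectSum.of_eq_of_ne _ _ _ h, map_zero]
      exact DirectSum.of_eq_of_ne _ _ _ (by omega)
  | add x y hx hy => rw [map_add, DirectSum.add_apply, hx, hy, DirectSum.add_apply, map_add]

theorem br_lof_apply {p q r : ℕ} (h : p + q = r + 1) (x : 𝔤.C p) (y : 𝔤.Total) :
    𝔤.br (DirectSum.lof 𝕜 ℕ 𝔤.C p x) y r = 𝔤.bracket p q r h x (y q) := by
  induction y using DirectSum.induction_on with
  | zero => simp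
  | of m y =>
    rcases Nat.eq_zero_or_pos (p + m) with h0 | h0
    · obtain ⟨rfl, rfl⟩ : p = 0 ∧ m = 0 := by omega
      rw [DirectSum.of_eq_of_ne _ _ _ (show q ≠ 0 by omega), map_zero]
      exact congrArg (fun z : 𝔤.Total => z r) (br_lof_zero_zero x y)
    refine (congrArg (fun z : 𝔤.Total => z r)
      (br_lof (r := p + m - 1) (by omega) x y)).trans ?_
    by_cases hm : q = m
    · subst hm
      obtain rfl : r = p + q - 1 := by omega
      rw [DirectSum.lof_apply, DirectSum.of_eq_same]
    · rw [DirectSum.of_eq_of_ne _ _ _ hm, map_zero]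
      exact DirectSum.of_eq_of_ne _ _ _ (by omega)
  | add y z hy hz => rw [map_add, DirectSum.add_apply, hy, hz, DirectSum.add_apply, map_add]

theorem br_lof_apply_eq_zero {p r : ℕ} (h : r + 1 < p) (x : 𝔤.C p) (y : 𝔤.Total) :
    𝔤.br (DirectSum.lof 𝕜 ℕ 𝔤.C p x) y r = 0 := by
  induction y using DirectSum.induction_on with
  | zero => simp
  | of m y =>
    refine (congrArg (fun z : 𝔤.Total => z r)
      (br_lof (r := p + m - 1) (by omega) x y)).trans ?_
    exact DirectSum.of_eq_of_ne _ _ _ (by omega)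
  | add y z hy hz => rw [map_add, DirectSum.add_apply, hy, hz, add_zero]

theorem diff_mem_gr {x : 𝔤.Total} {k : ℤ} (hx : x ∈ 𝔤.gr k) : 𝔤.diff x ∈ 𝔤.gr (k + 1) := by
  rcases eq_zero_or_eq_lof_of_mem_gr hx with rfl | ⟨n, hn, y, rfl⟩
  · rw [map_zero]; exact zero_mem _
  · rw [diff_lof]
    exact lof_mem_gr (by push_cast; omega) _

theorem br_mem_gr {x y : 𝔤.Total} {j k : ℤ} (hx : x ∈ 𝔤.gr j) (hy : y ∈ 𝔤.gr k) :
    𝔤.br x y ∈ 𝔤.gr (j + k) := by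
  rcases eq_zero_or_eq_lof_of_mem_gr hx with rfl | ⟨p, hp, x, rfl⟩
  · simp
  rcases eq_zero_or_eq_lof_of_mem_gr hy with rfl | ⟨q, hq, y, rfl⟩
  · simp
  rcases Nat.eq_zero_or_pos (p + q) with h0 | h0
  · obtain ⟨rfl, rfl⟩ : p = 0 ∧ q = 0 := by omega
    rw [br_lof_zero_zero]; exact zero_mem _
  rw [br_lof (r := p + q - 1) (by omega)]
  exact lof_mem_gr (by omega) _

theorem HasDerivedBracket.br_symm (H : 𝔤.HasDerivedBracket) {x y : 𝔤.Total} {j k : ℤ}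
    (hj : Odd j) (hk : Odd k) (hx : x ∈ 𝔤.gr j) (hy : y ∈ 𝔤.gr k) : 𝔤.br x y = 𝔤.br y x := by
  rcases eq_zero_or_eq_lof_of_mem_gr hx with rfl | ⟨p, hp, x, rfl⟩
  · simp
  rcases eq_zero_or_eq_lof_of_mem_gr hy with rfl | ⟨q, hq, y, rfl⟩
  · simp
  rcases Nat.eq_zero_or_pos (p + q) with h0 | h0
  · obtain ⟨rfl, rfl⟩ : p = 0 ∧ q = 0 := by omega
    rw [br_lof_zero_zero, br_lof_zero_zero]
  rw [br_lof (r := p + q - 1) (by omega), br_lof (r := p + q - 1) (by omega),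
    H.bracket_symm p q _ _ (by omega)]
  · rw [← hp] at hj; rw [← Int.even_coe_nat]; simpa using hj.add_one
  · rw [← hq] at hk; rw [← Int.even_coe_nat]; simpa using hk.add_one

theorem HasDerivedBracket.br_br_antisymm (H : 𝔤.HasDerivedBracket) {x f g : 𝔤.Total}
    (hx : x ∈ 𝔤.gr 1) (hf : f ∈ 𝔤.gr (-1)) (hg : g ∈ 𝔤.gr (-1)) :
    𝔤.br f (𝔤.br x g) = - 𝔤.br g (𝔤.br x f) := by
  rw [eq_lof_of_mem_gr hx (n := 2) (by norm_num), eq_lof_of_mem_gr hf (n := 0) (by norm_num),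
    eq_lof_of_mem_gr hg (n := 0) (by norm_num),
    br_lof (p := 2) (q := 0) (r := 1) rfl, br_lof (p := 2) (q := 0) (r := 1) rfl,
    br_lof (p := 0) (q := 1) (r := 0) rfl, br_lof (p := 0) (q := 1) (r := 0) rfl,
    H.derived_antisymm, map_neg]

theorem HasDerivedBracket.diff_eq_zero (H : 𝔤.HasDerivedBracket) {f : 𝔤.Total}
    (hf : f ∈ 𝔤.gr (-1)) : 𝔤.diff f = 0 := by
  rw [eq_lof_of_mem_gr hf (n := 0) (by norm_num), diff_lof, H.d_zero]
  simp

end Homogeneous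

/-! ### Series converging component by component -/

section Series

variable {𝕜 : Type*} [Field 𝕜] {𝔤 : GradedBracketComplex 𝕜} [∀ n, TopologicalSpace (𝔤.C n)]

/-- The series `∑ₚ u p` converges to `x`, component by component, in the order of summation. -/
def SeriesConvergesTo (u : ℕ → 𝔤.Total) (x : 𝔤.Total) : Prop :=
  𝔤.ConvergesTo (fun N => ∑ p ∈ Finset.range N, u p) x

/-- The sequence `0, u 0, u 1, …`. -/
def shift (u : ℕ → 𝔤.Total) : ℕ → 𝔤.Total
  | 0 => 0
  | p + 1 => u p

namespace SeriesConvergesTo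

variable {u v : ℕ → 𝔤.Total} {x y : 𝔤.Total}

theorem unique [∀ n, T2Space (𝔤.C n)] (hx : SeriesConvergesTo u x)
    (hy : SeriesConvergesTo u y) : x = y := by
  ext1 n
  exact tendsto_nhds_unique (hx n) (hy n)

theorem add [∀ n, IsTopologicalAddGroup (𝔤.C n)] (hu : SeriesConvergesTo u x)
    (hv : SeriesConvergesTo v y) : SeriesConvergesTo (fun p => u p + v p) (x + y) := by
  intro n
  simpa only [Finset.sum_add_distrib, DirectSum.add_apply] using (hu n).add (hv n)

theorem shift (hu : SeriesConvergesTo u x) : SeriesConvergesTo (shift u) x := by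
  intro n
  rw [← tendsto_add_atTop_iff_nat 1]
  simpa only [Finset.sum_range_succ', GradedBracketComplex.shift, add_zero] using hu n

theorem diff (hd : ∀ n, Continuous (𝔤.d n)) (hu : SeriesConvergesTo u x) :
    SeriesConvergesTo (fun p => 𝔤.diff (u p)) (𝔤.diff x) := by
  intro n
  simp only [← map_sum]
  cases n with
  | zero => simp only [diff_apply_zero, tendsto_const_nhds]
  | succ n =>
    simp only [diff_apply_succ]
    exact ((hd n).tendsto _).comp (hu n)

theorem br (hbr : ∀ (p q r : ℕ) (h : p + q = r + 1) (x : 𝔤.C p),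
    Continuous (𝔤.bracket p q r h x)) {k : ℤ} (hy : y ∈ 𝔤.gr k) (hu : SeriesConvergesTo u x) :
    SeriesConvergesTo (fun p => 𝔤.br y (u p)) (𝔤.br y x) := by
  intro n
  simp only [← map_sum]
  rcases eq_zero_or_eq_lof_of_mem_gr hy with rfl | ⟨p, -, y, rfl⟩
  · simp [tendsto_const_nhds]
  by_cases h : n + 1 < p
  · simp only [br_lof_apply_eq_zero h, tendsto_const_nhds]
  · simp only [br_lof_apply (q := n + 1 - p) (show p + (n + 1 - p) = n + 1 by omega)]
    exact ((hbr _ _ _ _ y).tendsto _).comp (hu _)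

theorem mem_gr [∀ n, T2Space (𝔤.C n)] {k : ℤ} (h : ∀ p, u p ∈ 𝔤.gr k)
    (hu : SeriesConvergesTo u x) : x ∈ 𝔤.gr k := by
  intro n hn
  refine tendsto_nhds_unique (hu n) ?_
  simp only [Submodule.sum_mem (𝔤.gr k) (fun p _ => h p) n hn, tendsto_const_nhds]

end SeriesConvergesTo

end Series

end GradedBracketComplex

end DeformationTheory

/-! ### Taylor coefficients on arguments of odd degree -/

namespace DeformationTheory

section Tuples

variable {α : Type*}

theorem removeNth_succ_cons {n : ℕ} (i : Fin (n + 1)) (x : α) (w : Fin (n + 1) → α) :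
    i.succ.removeNth (Fin.cons x w : Fin (n + 2) → α) = Fin.cons x (i.removeNth w) := by
  funext j
  refine Fin.cases ?_ (fun j => ?_) j <;> simp [Fin.removeNth]

theorem removeNth_zero_cons {n : ℕ} (x : α) (w : Fin n → α) :
    (0 : Fin (n + 1)).removeNth (Fin.cons x w : Fin (n + 1) → α) = w := by
  simp

theorem exists_removeNth_update_const {n : ℕ} {k l : Fin (n + 2)} (h : k ≠ l) (π z : α) :
    ∃ i : Fin (n + 1), l.removeNth (update (fun _ : Fin (n + 2) => π) k z) =
      i.insertNth z (fun _ => π) := by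
  obtain ⟨i, rfl⟩ := Fin.exists_succAbove_eq h
  refine ⟨i, Fin.eq_insertNth_iff.2 ⟨by simp [Fin.removeNth], ?_⟩⟩
  funext j
  simp [Fin.removeNth, update_of_ne]

theorem update_const_eq_insertNth {n : ℕ} (k : Fin (n + 1)) (π z : α) :
    update (fun _ : Fin (n + 1) => π) k z = k.insertNth z (fun _ => π) := by
  refine Fin.eq_insertNth_iff.2 ⟨by simp, ?_⟩
  funext j
  simp [Fin.removeNth, update_of_ne]

variable {𝕜 E : Type*} [Field 𝕜] [CharZero 𝕜] [AddCommGroup E] [Module 𝕜 E]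

/-- Replacing one of `p + 1` equal arguments in all possible ways turns the coefficient
`1 / (p + 1)!` into `1 / p!`. -/
theorem smul_sum_update_const (p : ℕ) (Φ : (Fin (p + 1) → α) → E) {π z : α} {R : E}
    (h : ∀ i : Fin (p + 1), Φ (i.insertNth z fun _ => π) = R) :
    (((p + 1)! : ℕ) : 𝕜)⁻¹ • ∑ k, Φ (update (fun _ => π) k z) = ((p ! : ℕ) : 𝕜)⁻¹ • R := by
  simp only [update_const_eq_insertNth, h, Finset.sum_const, Finset.card_univ, Fintype.card_fin]
  rw [← Nat.cast_smul_eq_nsmul 𝕜, smul_smul]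
  congr 1
  have h1 : (p ! : 𝕜) ≠ 0 := by exact_mod_cast Nat.factorial_ne_zero p
  have h2 : (p : 𝕜) + 1 ≠ 0 := by exact_mod_cast Nat.succ_ne_zero p
  rw [Nat.factorial_succ]
  push_cast
  field_simp

/-- Contracting a pair of `p + 2` equal arguments in all possible ways turns the coefficient
`1 / (p + 2)!` into `1 / (2 p!)`. -/
theorem smul_sum_removeNth_update_const (p : ℕ) (Φ : (Fin (p + 1) → α) → E) {π z : α} {R : E}
    (h : ∀ i : Fin (p + 1), Φ (i.insertNth z fun _ => π) = R) :
    (((p + 2)! : ℕ) : 𝕜)⁻¹ • ∑ k : Fin (p + 2), ∑ l ∈ Finset.Ioi k,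
      Φ (l.removeNth (update (fun _ => π) k z)) = ((p ! : ℕ) : 𝕜)⁻¹ • (2 : 𝕜)⁻¹ • R := by
  have hR : ∀ k : Fin (p + 2), ∀ l ∈ Finset.Ioi k,
      Φ (l.removeNth (update (fun _ => π) k z)) = R := by
    intro k l hl
    obtain ⟨i, hi⟩ := exists_removeNth_update_const (Finset.mem_Ioi.1 hl).ne π z
    rw [hi, h]
  have hcard : ∑ k : Fin (p + 2), (Finset.Ioi k).card = (p + 2).choose 2 := by
    simp only [Fin.card_Ioi]
    rw [Fin.sum_univ_eq_sum_range (fun k => p + 2 - 1 - k), Finset.sum_range_reflect (fun k => k),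
      Finset.sum_range_id, Nat.choose_two_right]
  rw [Finset.sum_congr rfl fun k _ => Finset.sum_congr rfl (hR k)]
  simp only [Finset.sum_const]
  rw [← Finset.sum_smul, hcard, ← Nat.cast_smul_eq_nsmul 𝕜, smul_smul, smul_smul]
  congr 1
  have h1 : (p ! : 𝕜) ≠ 0 := by exact_mod_cast Nat.factorial_ne_zero p
  have h2 : (p : 𝕜) + 1 ≠ 0 := by exact_mod_cast Nat.succ_ne_zero p
  have h3 : (p : 𝕜) + 1 + 1 ≠ 0 := by exact_mod_cast Nat.succ_ne_zero (p + 1)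
  rw [Nat.cast_choose_two, Nat.factorial_succ, Nat.factorial_succ]
  push_cast
  field_simp
  ring

end Tuples

namespace GradedBracketComplex

variable {𝕜 : Type*} [Field 𝕜] {𝔤 : GradedBracketComplex 𝕜}

/-- Homogeneous elements of odd degree; they are even for the shifted grading of `𝔤[1]`. -/
def IsOdd (x : 𝔤.Total) : Prop := ∃ k : ℤ, Odd k ∧ x ∈ 𝔤.gr k

theorem HasDerivedBracket.br_symm_of_isOdd (H : 𝔤.HasDerivedBracket) {x y : 𝔤.Total}
    (hx : IsOdd x) (hy : IsOdd y) : 𝔤.br x y = 𝔤.br y x := by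
  obtain ⟨j, hj, hx⟩ := hx
  obtain ⟨k, hk, hy⟩ := hy
  exact H.br_symm hj hk hx hy

namespace LInftyDerivation

variable (X : 𝔤.LInftyDerivation)

/-- A Taylor coefficient is symmetric in arguments of which all but one have odd degree. -/
theorem coeff_insertNth {n : ℕ} {z : 𝔤.Total} {kz : ℤ} (hz : z ∈ 𝔤.gr kz) {c : Fin n → 𝔤.Total}
    (hc : ∀ i, IsOdd (c i)) (i : Fin (n + 1)) :
    X.coeff (n + 1) (i.insertNth z c) = X.coeff (n + 1) (Fin.cons z c) := by
  choose k hk hc using hc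
  induction i using Fin.induction with
  | zero => rw [Fin.insertNth_zero']
  | succ i ih =>
    rw [← ih]
    have hswap : (i.succ.insertNth z c : Fin (n + 1) → 𝔤.Total) =
        (i.castSucc.insertNth z c : Fin (n + 1) → 𝔤.Total) ∘ Equiv.swap i.castSucc i.succ := by
      refine (Fin.eq_insertNth_iff.2 ⟨by simp, ?_⟩).symm
      funext j
      by_cases hj : j = i
      · subst hj
        have := Fin.insertNth_apply_succAbove (α := fun _ => 𝔤.Total) j.castSucc z c j
        rw [Fin.succAbove_castSucc_self] at this
        simp [Fin.removeNth, this]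
      · have h1 : i.succ.succAbove j ≠ i.succ := Fin.succAbove_ne _ _
        have h2 : i.succ.succAbove j ≠ i.castSucc := by
          rw [← Fin.succAbove_succ_self i]
          exact fun e => hj (Fin.succAbove_right_injective e)
        have h3 : i.succ.succAbove j = i.castSucc.succAbove j := by
          rcases lt_or_gt_of_ne hj with h | h
          · rw [Fin.succAbove_of_castSucc_lt _ _ (Fin.castSucc_lt_succ_iff.2 h.le),
              Fin.succAbove_of_castSucc_lt _ _ (by simpa using h)]
          · rw [Fin.succAbove_of_le_castSucc _ _ (Fin.succ_le_castSucc_iff.2 h),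
              Fin.succAbove_of_le_castSucc _ _ (by simpa using h.le)]
        rw [Fin.removeNth, comp_apply, Equiv.swap_apply_of_ne_of_ne h2 h1, h3,
          Fin.insertNth_apply_succAbove]
    have hki : (i.castSucc.insertNth kz k : Fin (n + 1) → ℤ) i.succ = k i := by
      have := Fin.insertNth_apply_succAbove (α := fun _ => ℤ) i.castSucc kz k i
      rwa [Fin.succAbove_castSucc_self] at this
    rw [hswap, X.coeff_swap (n + 1) (i.castSucc.insertNth kz k) _ ?_ _ _ (by simp), hki,
      Int.negOnePow_even _ (((hk i).sub_odd odd_one).mul_left _), one_smul]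
    intro j
    refine Fin.succAboveCases i.castSucc ?_ (fun j => ?_) j
    · simpa using hz
    · simpa using hc j

theorem coeff_cons_comm {n : ℕ} {a z : 𝔤.Total} {kz : ℤ} (hz : z ∈ 𝔤.gr kz) (ha : IsOdd a)
    {c : Fin n → 𝔤.Total} (hc : ∀ i, IsOdd (c i)) (i : Fin (n + 1)) :
    X.coeff (n + 2) (Fin.cons a (i.insertNth z c)) =
      X.coeff (n + 2) (Fin.cons a (Fin.cons z c)) := by
  have hac : ∀ j, IsOdd ((Fin.cons a c : Fin (n + 1) → 𝔤.Total) j) :=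
    fun j => Fin.cases ha hc j
  have h1 := X.coeff_insertNth hz hac i.succ
  have h2 := X.coeff_insertNth hz hac (Fin.succ 0)
  rw [Fin.insertNth_succ_cons] at h1 h2
  rw [Fin.insertNth_zero'] at h2
  rw [h1, h2]

theorem coeff_cons_cons_comm {n : ℕ} {a b z : 𝔤.Total} {kz : ℤ} (hz : z ∈ 𝔤.gr kz)
    (ha : IsOdd a) (hb : IsOdd b) {c : Fin n → 𝔤.Total} (hc : ∀ i, IsOdd (c i))
    (i : Fin (n + 1)) :
    X.coeff (n + 3) (Fin.cons a (Fin.cons b (i.insertNth z c))) =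
      X.coeff (n + 3) (Fin.cons a (Fin.cons b (Fin.cons z c))) := by
  have hbc : ∀ j, IsOdd ((Fin.cons b c : Fin (n + 1) → 𝔤.Total) j) :=
    fun j => Fin.cases hb hc j
  have h1 := X.coeff_cons_comm hz ha hbc i.succ
  have h2 := X.coeff_cons_comm hz ha hbc (Fin.succ 0)
  rw [Fin.insertNth_succ_cons] at h1 h2
  rw [Fin.insertNth_zero'] at h2
  rw [h1, h2]

/-- On arguments of odd degree all signs in the compatibility with the codifferential are `1`. -/
theorem comm_codiff_of_isOdd (H : 𝔤.HasDerivedBracket) {n : ℕ} (a : Fin (n + 1) → 𝔤.Total)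
    (ha : ∀ i, IsOdd (a i)) :
    𝔤.diff (X.coeff (n + 1) a) + ∑ i, 𝔤.br (a i) (X.coeff n (i.removeNth a)) =
      ∑ i, X.coeff (n + 1) (update a i (𝔤.diff (a i))) +
        ∑ i, ∑ j ∈ Finset.Ioi i, X.coeff n (Fin.removeNth j (update a i (𝔤.br (a j) (a i)))) := by
  have ha' := ha
  choose k hk hak using ha
  have hev : ∀ s : Finset (Fin (n + 1)), Even (∑ l ∈ s, (k l - 1)) := fun s =>
    Finset.even_sum _ fun l _ => (hk l).sub_odd odd_one
  have hev' : ∀ i, Even (k i - 1) := fun i => (hk i).sub_odd odd_one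
  have h := X.comm_codiff n k a hak
  have hbr : ∀ i, 𝔤.br (X.coeff n (i.removeNth a)) (a i) =
      𝔤.br (a i) (X.coeff n (i.removeNth a)) := by
    intro i
    refine H.br_symm_of_isOdd ⟨_, ?_, X.coeff_mem n (i.removeNth k) _ fun j => hak _⟩ (ha' i)
    exact (Finset.even_sum _ fun l _ => hev' _).add_one
  simp only [Int.negOnePow_even _ (hev _), Int.negOnePow_even _ (hev' _),
    Int.negOnePow_even _ ((hev' _).mul_right _),
    Int.negOnePow_even _ ((hev _).add ((hev' _).mul_right _)), one_smul, hbr] at h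
  rw [h]
  congr 1
  refine Finset.sum_congr rfl fun i _ => Finset.sum_congr rfl fun j _ => ?_
  rw [H.br_symm_of_isOdd (ha' i) (ha' j)]

end LInftyDerivation

end GradedBracketComplex

end DeformationTheory

/-! ### The compatibility with the codifferential at `π`, term by term -/

namespace DeformationTheory

/-- The tuple `w` preceded by the entries of a list. -/
def prepend {α : Type*} : (l : List α) → {p : ℕ} → (Fin p → α) → Fin (p + l.length) → α
  | [], _, w => w
  | a :: l, _, w => Fin.cons a (prepend l w)

theorem append_get_eq_prepend {α : Type*} (l : List α) {p : ℕ} (w : Fin p → α) :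
    Fin.append l.get w = prepend l w ∘ Fin.cast (Nat.add_comm l.length p) := by
  induction l with
  | nil =>
    funext i
    simp [prepend, Fin.append, Fin.addCases]
  | cons a l ih =>
    have hget : (a :: l).get = Fin.cons a l.get := by
      funext i
      refine Fin.cases rfl (fun i => rfl) i
    rw [hget]
    refine (Fin.append_cons a l.get w).trans ?_
    rw [ih]
    funext i
    obtain ⟨i, hi⟩ := i
    cases i <;> rfl

namespace GradedBracketComplex

namespace LInftyDerivation

variable {𝕜 : Type*} [RCLike 𝕜] {𝔤 : GradedBracketComplex 𝕜} (X : 𝔤.LInftyDerivation)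

/-- The terms `(1 / p!) X_{n+p}(a₁, …, aₙ, π, …, π)` of the series defining the twisted Taylor
coefficient, the arguments `a₁, …, aₙ` being given as a list. -/
def twistTerm (π : 𝔤.Total) (l : List 𝔤.Total) (p : ℕ) : 𝔤.Total :=
  ((p ! : ℕ) : 𝕜)⁻¹ • X.coeff (p + l.length) (prepend l fun _ => π)

theorem coeff_comp_cast {m n : ℕ} (h : m = n) (w : Fin n → 𝔤.Total) :
    X.coeff m (w ∘ Fin.cast h) = X.coeff n w := by
  subst h
  rfl

theorem twistPartialSum_get (π : 𝔤.Total) (l : List 𝔤.Total) (N : ℕ) :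
    X.twistPartialSum π l.length l.get N = ∑ p ∈ Finset.range N, X.twistTerm π l p := by
  refine Finset.sum_congr rfl fun p _ => ?_
  rw [append_get_eq_prepend, coeff_comp_cast]
  rfl

variable {X} {π : 𝔤.Total}

theorem twistTerm_add (x y : 𝔤.Total) (p : ℕ) :
    X.twistTerm π [x + y] p = X.twistTerm π [x] p + X.twistTerm π [y] p :=
  (congrArg _ ((X.coeff (p + 1)).cons_add (fun _ => π) x y)).trans (smul_add _ _ _)

theorem twistTerm_add_cons (a x y : 𝔤.Total) (p : ℕ) :
    X.twistTerm π [x + y, a] p = X.twistTerm π [x, a] p + X.twistTerm π [y, a] p :=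
  (congrArg _ ((X.coeff (p + 2)).cons_add (Fin.cons a fun _ => π) x y)).trans (smul_add _ _ _)

theorem twistTerm_cons_add (a x y : 𝔤.Total) (p : ℕ) :
    X.twistTerm π [a, x + y] p = X.twistTerm π [a, x] p + X.twistTerm π [a, y] p :=
  (congrArg _ (((X.coeff (p + 2)).curryLeft a).cons_add (fun _ => π) x y)).trans (smul_add _ _ _)

theorem twistTerm_cons_cons_add (a b x y : 𝔤.Total) (p : ℕ) :
    X.twistTerm π [a, b, x + y] p = X.twistTerm π [a, b, x] p + X.twistTerm π [a, b, y] p :=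
  (congrArg _ ((((X.coeff (p + 3)).curryLeft a).curryLeft b).cons_add
    (fun _ => π) x y)).trans (smul_add _ _ _)

/-- The compatibility with the codifferential on the arguments `π, …, π`. A term in which one
(respectively two) of the arguments `π` is consumed contributes to the series with its index shifted
by one (respectively two). -/
theorem comm_codiff_nil (H : 𝔤.HasDerivedBracket) (hπ : π ∈ 𝔤.gr 1) (p : ℕ) :
    𝔤.diff (X.twistTerm π [] p) + shift (fun q => 𝔤.br π (X.twistTerm π [] q)) p =
      shift (X.twistTerm π [𝔤.diff π]) p +
        shift (shift (X.twistTerm π [(2 : 𝕜)⁻¹ • 𝔤.br π π])) p := by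
  have hπ' : IsOdd π := ⟨1, odd_one, hπ⟩
  rcases p with _ | p
  · simp [shift, twistTerm, X.coeff_zero]
  have h := X.comm_codiff_of_isOdd H (n := p) (fun _ => π) fun _ => hπ'
  -- `d` applied to one of the arguments `π`
  have h1 := smul_sum_update_const (𝕜 := 𝕜) p (X.coeff (p + 1)) (π := π) (z := 𝔤.diff π) fun i =>
    X.coeff_insertNth (diff_mem_gr hπ) (fun _ => hπ') i
  -- two of the arguments `π` bracketed with each other
  have h2 : (((p + 1)! : ℕ) : 𝕜)⁻¹ • ∑ k : Fin (p + 1), ∑ l ∈ Finset.Ioi k,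
      X.coeff p (Fin.removeNth l (update (fun _ => π) k (𝔤.br π π))) =
      shift (X.twistTerm π [(2 : 𝕜)⁻¹ • 𝔤.br π π]) p := by
    rcases p with _ | p
    · simp [shift]
    · refine (smul_sum_removeNth_update_const p (X.coeff (p + 1)) fun i =>
        X.coeff_insertNth (br_mem_gr hπ hπ) (fun _ => hπ') i).trans ?_
      exact congrArg _ ((X.coeff (p + 1)).cons_smul (fun _ => π) _ _).symm
  -- one of the arguments `π` bracketed with something not depending on its position
  have h3 : (((p + 1)! : ℕ) : 𝕜)⁻¹ • ∑ i : Fin (p + 1),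
      𝔤.br π (X.coeff p (i.removeNth fun _ => π)) = 𝔤.br π (X.twistTerm π [] p) := by
    simp only [Fin.removeNth_fun_const]
    rw [twistTerm, map_smul]
    refine smul_sum_update_const (𝕜 := 𝕜) p (fun w => 𝔤.br π (X.coeff p (fun _ => π)))
      (π := π) (z := π) fun _ => rfl
  have h' := congrArg ((((p + 1)! : ℕ) : 𝕜)⁻¹ • ·) h
  simp only [smul_add] at h'
  rw [h1, h2, h3, ← map_smul] at h'
  exact h'

/-- The compatibility with the codifferential on the arguments `a, π, …, π`. -/
theorem comm_codiff_singleton (H : 𝔤.HasDerivedBracket) (hπ : π ∈ 𝔤.gr 1) {a : 𝔤.Total}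
    (ha : IsOdd a) (p : ℕ) :
    𝔤.diff (X.twistTerm π [a] p) + shift (fun q => 𝔤.br π (X.twistTerm π [a] q)) p +
        𝔤.br a (X.twistTerm π [] p) =
      X.twistTerm π [𝔤.diff a] p + shift (X.twistTerm π [a, 𝔤.diff π]) p +
        shift (X.twistTerm π [𝔤.br π a]) p +
        shift (shift (X.twistTerm π [a, (2 : 𝕜)⁻¹ • 𝔤.br π π])) p := by
  have hπ' : IsOdd π := ⟨1, odd_one, hπ⟩
  have h := X.comm_codiff_of_isOdd H (n := p) (Fin.cons a fun _ => π)
    fun i => Fin.cases ha (fun _ => hπ') i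
  rcases p with _ | p
  · simpa [shift, twistTerm, prepend, X.coeff_zero] using h
  -- `d` applied to one of the arguments `π`
  have h1 := smul_sum_update_const (𝕜 := 𝕜) p
    (fun w => X.coeff (p + 2) (Fin.cons a w)) (π := π) (z := 𝔤.diff π) fun i =>
    X.coeff_cons_comm (diff_mem_gr hπ) ha (fun _ => hπ') i
  -- two of the arguments `π` bracketed with each other
  have h2 : (((p + 1)! : ℕ) : 𝕜)⁻¹ • ∑ k : Fin (p + 1), ∑ l ∈ Finset.Ioi k,
      X.coeff (p + 1) (Fin.cons a (Fin.removeNth l (update (fun _ => π) k (𝔤.br π π)))) =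
      shift (X.twistTerm π [a, (2 : 𝕜)⁻¹ • 𝔤.br π π]) p := by
    rcases p with _ | p
    · simp [shift]
    · refine (smul_sum_removeNth_update_const p (fun w => X.coeff (p + 2) (Fin.cons a w)) fun i =>
        X.coeff_cons_comm (br_mem_gr hπ hπ) ha (fun _ => hπ') i).trans ?_
      exact congrArg _ (((X.coeff (p + 2)).curryLeft a).cons_smul (fun _ => π) _ _).symm
  -- one of the arguments `π` bracketed with something not depending on its position
  have h3 : ∀ e : 𝔤.Total, (((p + 1)! : ℕ) : 𝕜)⁻¹ • ∑ _i : Fin (p + 1), e =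
      ((p ! : ℕ) : 𝕜)⁻¹ • e := fun e =>
    smul_sum_update_const (𝕜 := 𝕜) p (fun _ => e) (π := π) (z := π) fun _ => rfl
  simp only [Fin.sum_univ_succ (n := p + 1), Fin.sum_Ioi_zero, Fin.sum_Ioi_succ, Fin.cons_zero,
    Fin.cons_succ, removeNth_succ_cons, removeNth_zero_cons, Fin.removeNth_fun_const,
    Fin.update_cons_zero, ← Fin.cons_update] at h
  have h' := congrArg ((((p + 1)! : ℕ) : 𝕜)⁻¹ • ·) h
  simp only [smul_add] at h'
  rw [h1, h2, h3, h3] at h'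
  change _ + _ + _ = _ + _ + _ + shift (X.twistTerm π [a, (2 : 𝕜)⁻¹ • 𝔤.br π π]) p
  generalize shift (X.twistTerm π [a, (2 : 𝕜)⁻¹ • 𝔤.br π π]) p = S at h' ⊢
  simp only [← map_smul, ← add_assoc] at h'
  exact (add_right_comm _ _ _).trans h'

/-- The compatibility with the codifferential on the arguments `a, b, π, …, π`. -/
theorem comm_codiff_pair (H : 𝔤.HasDerivedBracket) (hπ : π ∈ 𝔤.gr 1) {a b : 𝔤.Total}
    (ha : IsOdd a) (hb : IsOdd b) (p : ℕ) :
    𝔤.diff (X.twistTerm π [a, b] p) + 𝔤.br a (X.twistTerm π [b] p) +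
        𝔤.br b (X.twistTerm π [a] p) + shift (fun q => 𝔤.br π (X.twistTerm π [a, b] q)) p =
      X.twistTerm π [𝔤.diff a, b] p + X.twistTerm π [a, 𝔤.diff b] p +
        shift (X.twistTerm π [a, b, 𝔤.diff π]) p + X.twistTerm π [𝔤.br b a] p +
        shift (X.twistTerm π [𝔤.br π a, b]) p + shift (X.twistTerm π [a, 𝔤.br π b]) p +
        shift (shift (X.twistTerm π [a, b, (2 : 𝕜)⁻¹ • 𝔤.br π π])) p := by
  have hπ' : IsOdd π := ⟨1, odd_one, hπ⟩
  have h := X.comm_codiff_of_isOdd H (n := p + 1) (Fin.cons a (Fin.cons b fun _ => π))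
    fun i => Fin.cases ha (fun i => Fin.cases hb (fun _ => hπ') i) i
  rcases p with _ | p
  · simp only [Fin.sum_univ_succ (n := 1), Fin.sum_univ_succ (n := 0), Fin.sum_Ioi_zero,
      Fin.sum_Ioi_succ, Fin.cons_zero, Fin.cons_succ, removeNth_succ_cons, removeNth_zero_cons,
      Fin.update_cons_zero, ← Fin.cons_update, Finset.univ_eq_empty, Finset.sum_empty,
      add_zero] at h
    simpa [shift, twistTerm, prepend, add_assoc] using h
  -- `d` applied to one of the arguments `π`
  have h1 := smul_sum_update_const (𝕜 := 𝕜) p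
    (fun w => X.coeff (p + 3) (Fin.cons a (Fin.cons b w))) (π := π) (z := 𝔤.diff π) fun i =>
    X.coeff_cons_cons_comm (diff_mem_gr hπ) ha hb (fun _ => hπ') i
  -- two of the arguments `π` bracketed with each other
  have h2 : (((p + 1)! : ℕ) : 𝕜)⁻¹ • ∑ k : Fin (p + 1), ∑ l ∈ Finset.Ioi k,
      X.coeff (p + 2) (Fin.cons a (Fin.cons b
        (Fin.removeNth l (update (fun _ => π) k (𝔤.br π π))))) =
      shift (X.twistTerm π [a, b, (2 : 𝕜)⁻¹ • 𝔤.br π π]) p := by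
    rcases p with _ | p
    · simp [shift]
    · refine (smul_sum_removeNth_update_const p
        (fun w => X.coeff (p + 3) (Fin.cons a (Fin.cons b w))) fun i =>
        X.coeff_cons_cons_comm (br_mem_gr hπ hπ) ha hb (fun _ => hπ') i).trans ?_
      exact congrArg _
        ((((X.coeff (p + 3)).curryLeft a).curryLeft b).cons_smul (fun _ => π) _ _).symm
  -- one of the arguments `π` bracketed with something not depending on its position
  have h3 : ∀ e : 𝔤.Total, (((p + 1)! : ℕ) : 𝕜)⁻¹ • ∑ _i : Fin (p + 1), e =
      ((p ! : ℕ) : 𝕜)⁻¹ • e := fun e =>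
    smul_sum_update_const (𝕜 := 𝕜) p (fun _ => e) (π := π) (z := π) fun _ => rfl
  simp only [Fin.sum_univ_succ (n := p + 2), Fin.sum_univ_succ (n := p + 1), Fin.sum_Ioi_zero,
    Fin.sum_Ioi_succ, Fin.cons_zero, Fin.cons_succ, removeNth_succ_cons, removeNth_zero_cons,
    Fin.removeNth_fun_const, Fin.update_cons_zero, ← Fin.cons_update] at h
  have h' := congrArg ((((p + 1)! : ℕ) : 𝕜)⁻¹ • ·) h
  simp only [smul_add] at h'
  rw [h1, h2, h3, h3, h3] at h'
  change _ + _ + _ + _ = _ + _ + _ + _ + _ + _ +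
    shift (X.twistTerm π [a, b, (2 : 𝕜)⁻¹ • 𝔤.br π π]) p
  generalize shift (X.twistTerm π [a, b, (2 : 𝕜)⁻¹ • 𝔤.br π π]) p = S at h' ⊢
  simp only [← map_smul, ← add_assoc] at h'
  exact h'

end LInftyDerivation

end GradedBracketComplex

end DeformationTheory

/-! ### Twisted Taylor coefficients -/

namespace DeformationTheory

namespace GradedBracketComplex

namespace LInftyDerivation

variable {𝕜 : Type*} [RCLike 𝕜] {𝔤 : GradedBracketComplex 𝕜} {X : 𝔤.LInftyDerivation}
  {π : 𝔤.Total} [∀ n, TopologicalSpace (𝔤.C n)]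

variable (X π) in
/-- The twisted Taylor coefficient with the arguments given as a list. -/
noncomputable def twistedList (l : List 𝔤.Total) : 𝔤.Total := X.twisted π l.length l.get

theorem atPoint_eq_twistedList : X.atPoint π = X.twistedList π [] :=
  congrArg (X.twisted π 0) (Subsingleton.elim _ _)

theorem twistedOne_eq_twistedList (a : 𝔤.Total) : X.twistedOne π a = X.twistedList π [a] :=
  congrArg (X.twisted π 1) (funext fun i => by rw [Subsingleton.elim i 0]; rfl)

theorem TwistConverges.seriesConvergesTo (hX : X.TwistConverges π) (l : List 𝔤.Total) :
    SeriesConvergesTo (X.twistTerm π l) (X.twistedList π l) := by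
  have h := hX l.length l.get
  have h' := h.choose_spec
  rw [twistedList, twisted, dif_pos h]
  intro n
  simpa only [twistPartialSum_get] using h' n

theorem StrongNijenhuis.twistedList_eq_zero (hN : X.StrongNijenhuis π) {l : List 𝔤.Total}
    (h : X.atPoint π ∈ l) : X.twistedList π l = 0 := by
  obtain ⟨i, hi⟩ := List.get_of_mem h
  exact hN _ _ ⟨i, hi⟩

section Convergence

variable [∀ n, T2Space (𝔤.C n)]

theorem atPoint_mem_gr (hX : X.TwistConverges π) (hπ : π ∈ 𝔤.gr 1) :
    X.atPoint π ∈ 𝔤.gr 1 := by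
  rw [atPoint_eq_twistedList]
  refine (hX.seriesConvergesTo []).mem_gr fun p => Submodule.smul_mem _ _ ?_
  have h := X.coeff_mem p (fun _ => 1) (fun _ => π) fun _ => hπ
  rw [sub_self, Finset.sum_const_zero, zero_add] at h
  exact h

theorem twistedOne_mem_gr (hX : X.TwistConverges π) (hπ : π ∈ 𝔤.gr 1) {a : 𝔤.Total} {k : ℤ}
    (ha : a ∈ 𝔤.gr k) : X.twistedOne π a ∈ 𝔤.gr k := by
  rw [twistedOne_eq_twistedList]
  refine (hX.seriesConvergesTo [a]).mem_gr fun p => Submodule.smul_mem _ _ ?_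
  have h := X.coeff_mem (p + 1) (Fin.cons k fun _ => 1) (Fin.cons a fun _ => π)
    fun i => Fin.cases ha (fun _ => hπ) i
  simp only [Fin.sum_univ_succ, Fin.cons_zero, Fin.cons_succ, sub_self, Finset.sum_const_zero,
    add_zero, sub_add_cancel] at h
  exact h

theorem twistedOne_iterate_mem_gr (hX : X.TwistConverges π) (hπ : π ∈ 𝔤.gr 1) {a : 𝔤.Total}
    {k : ℤ} (ha : a ∈ 𝔤.gr k) (n : ℕ) : (X.twistedOne π)^[n] a ∈ 𝔤.gr k := by
  induction n with
  | zero => exact ha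
  | succ n ih => rw [iterate_succ_apply']; exact twistedOne_mem_gr hX hπ ih

variable [∀ n, IsTopologicalAddGroup (𝔤.C n)]

theorem twistedList_add (hX : X.TwistConverges π) (x y : 𝔤.Total) :
    X.twistedList π [x + y] = X.twistedList π [x] + X.twistedList π [y] := by
  refine (hX.seriesConvergesTo _).unique ?_
  simpa only [← twistTerm_add] using (hX.seriesConvergesTo [x]).add (hX.seriesConvergesTo [y])

theorem twistedList_add_cons (hX : X.TwistConverges π) (a x y : 𝔤.Total) :
    X.twistedList π [x + y, a] = X.twistedList π [x, a] + X.twistedList π [y, a] := by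
  refine (hX.seriesConvergesTo _).unique ?_
  simpa only [← twistTerm_add_cons] using
    (hX.seriesConvergesTo [x, a]).add (hX.seriesConvergesTo [y, a])

theorem twistedList_cons_add (hX : X.TwistConverges π) (a x y : 𝔤.Total) :
    X.twistedList π [a, x + y] = X.twistedList π [a, x] + X.twistedList π [a, y] := by
  refine (hX.seriesConvergesTo _).unique ?_
  simpa only [← twistTerm_cons_add] using
    (hX.seriesConvergesTo [a, x]).add (hX.seriesConvergesTo [a, y])

theorem twistedList_cons_cons_add (hX : X.TwistConverges π) (a b x y : 𝔤.Total) :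
    X.twistedList π [a, b, x + y] = X.twistedList π [a, b, x] + X.twistedList π [a, b, y] := by
  refine (hX.seriesConvergesTo _).unique ?_
  simpa only [← twistTerm_cons_cons_add] using
    (hX.seriesConvergesTo [a, b, x]).add (hX.seriesConvergesTo [a, b, y])

theorem twistedList_zero (hX : X.TwistConverges π) : X.twistedList π [0] = 0 := by
  simpa using twistedList_add hX 0 0

theorem twistedList_cons_zero (hX : X.TwistConverges π) (a : 𝔤.Total) :
    X.twistedList π [a, 0] = 0 := by
  simpa using twistedList_cons_add hX a 0 0

theorem twistedList_cons_cons_zero (hX : X.TwistConverges π) (a b : 𝔤.Total) :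
    X.twistedList π [a, b, 0] = 0 := by
  simpa using twistedList_cons_cons_add hX a b 0 0

/-! ### The twisted identities -/

variable (H : 𝔤.HasDerivedBracket) (hd : ∀ n, Continuous (𝔤.d n))
  (hbr : ∀ (p q r : ℕ) (h : p + q = r + 1) (x : 𝔤.C p), Continuous (𝔤.bracket p q r h x))
  (hπ : 𝔤.IsMaurerCartan π) (hX : X.TwistConverges π)

include H hd hbr hπ hX

/-- `X(π)` is a cocycle for the twisted differential. -/
theorem twistedDiff_atPoint : 𝔤.twistedDiff π (X.atPoint π) = 0 := by
  have hL := (((hX.seriesConvergesTo []).diff hd).add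
    ((hX.seriesConvergesTo []).br hbr hπ.1).shift)
  have hR := (hX.seriesConvergesTo [𝔤.diff π]).shift.add
    (hX.seriesConvergesTo [(2 : 𝕜)⁻¹ • 𝔤.br π π]).shift.shift
  simp only [comm_codiff_nil H hπ.1] at hL
  have h := hL.unique hR
  rw [← twistedList_add hX, hπ.2, twistedList_zero hX, ← atPoint_eq_twistedList] at h
  exact h

/-- The commutator of the twisted differential with `X_{π,1}` is, up to sign, the bracket
with `X(π)`. -/
theorem twistedDiff_twistedOne {a : 𝔤.Total} (ha : IsOdd a) :
    𝔤.twistedDiff π (X.twistedOne π a) + 𝔤.br a (X.atPoint π) =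
      X.twistedOne π (𝔤.twistedDiff π a) := by
  obtain ⟨k, hk, hak⟩ := id ha
  have hL := (((hX.seriesConvergesTo [a]).diff hd).add
    ((hX.seriesConvergesTo [a]).br hbr hπ.1).shift).add
      ((hX.seriesConvergesTo []).br hbr hak)
  have hR := (((hX.seriesConvergesTo [𝔤.diff a]).add
    (hX.seriesConvergesTo [a, 𝔤.diff π]).shift).add
    (hX.seriesConvergesTo [𝔤.br π a]).shift).add
    (hX.seriesConvergesTo [a, (2 : 𝕜)⁻¹ • 𝔤.br π π]).shift.shift
  simp only [comm_codiff_singleton H hπ.1 ha] at hL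
  have h := hL.unique hR
  have h0 := twistedList_cons_add hX a (𝔤.diff π) ((2 : 𝕜)⁻¹ • 𝔤.br π π)
  rw [hπ.2, twistedList_cons_zero hX] at h0
  rw [add_right_comm _ (X.twistedList π [a, 𝔤.diff π]), add_assoc _ (X.twistedList π _), ← h0,
    add_zero, ← twistedList_add hX] at h
  simpa only [atPoint_eq_twistedList, twistedOne_eq_twistedList, twistedDiff] using h

/-- The compatibility of `X_{π,1}` with the bracket, up to homotopy `X_{π,2}`. -/
theorem twistedDiff_twistedList_pair {a b : 𝔤.Total} (ha : IsOdd a) (hb : IsOdd b) :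
    𝔤.twistedDiff π (X.twistedList π [a, b]) + 𝔤.br a (X.twistedOne π b) +
        𝔤.br b (X.twistedOne π a) =
      X.twistedList π [𝔤.twistedDiff π a, b] + X.twistedList π [a, 𝔤.twistedDiff π b] +
        X.twistedOne π (𝔤.br b a) := by
  obtain ⟨j, -, haj⟩ := id ha
  obtain ⟨k, -, hbk⟩ := id hb
  have hL := ((((hX.seriesConvergesTo [a, b]).diff hd).add
    ((hX.seriesConvergesTo [b]).br hbr haj)).add
    ((hX.seriesConvergesTo [a]).br hbr hbk)).add
    ((hX.seriesConvergesTo [a, b]).br hbr hπ.1).shift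
  have hR := ((((((hX.seriesConvergesTo [𝔤.diff a, b]).add
    (hX.seriesConvergesTo [a, 𝔤.diff b])).add
    (hX.seriesConvergesTo [a, b, 𝔤.diff π]).shift).add
    (hX.seriesConvergesTo [𝔤.br b a])).add
    (hX.seriesConvergesTo [𝔤.br π a, b]).shift).add
    (hX.seriesConvergesTo [a, 𝔤.br π b]).shift).add
    (hX.seriesConvergesTo [a, b, (2 : 𝕜)⁻¹ • 𝔤.br π π]).shift.shift
  simp only [comm_codiff_pair H hπ.1 ha hb] at hL
  have h := hL.unique hR
  have h0 := twistedList_cons_cons_add hX a b (𝔤.diff π) ((2 : 𝕜)⁻¹ • 𝔤.br π π)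
  rw [hπ.2, twistedList_cons_cons_zero hX] at h0
  simp only [twistedOne_eq_twistedList, twistedDiff, twistedList_add_cons hX,
    twistedList_cons_add hX]
  rw [add_right_comm _ (𝔤.br π _), add_right_comm _ (𝔤.br π _), h]
  rw [← sub_eq_zero]
  refine Eq.trans ?_ h0.symm
  abel

/-! ### Consequences of the strong Nijenhuis condition -/

variable (hN : X.StrongNijenhuis π)

include hN

/-- Under the strong Nijenhuis condition `X_{π,1}` commutes with the bracket with `X(π)`. -/
theorem twistedOne_br_atPoint {a : 𝔤.Total} (ha : IsOdd a) :
    X.twistedOne π (𝔤.br (X.atPoint π) a) = 𝔤.br (X.atPoint π) (X.twistedOne π a) := by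
  have hν : IsOdd (X.atPoint π) := ⟨1, odd_one, atPoint_mem_gr hX hπ.1⟩
  have h := twistedDiff_twistedList_pair H hd hbr hπ hX ha hν
  rw [twistedDiff_atPoint H hd hbr hπ hX, twistedList_cons_zero hX, add_zero,
    twistedOne_eq_twistedList (X.atPoint π), hN.twistedList_eq_zero (by simp),
    hN.twistedList_eq_zero (by simp), hN.twistedList_eq_zero (by simp)] at h
  simpa [twistedDiff] using h.symm

/-- `d_π X_{π,1}^n(f)` is a multiple of the bracket of `X(π)` with `X_{π,1}^{n-1}(f)`; for `n = 0`
the multiple is zero. -/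
theorem twistedDiff_twistedOne_iterate {f : 𝔤.Total} (hf : f ∈ 𝔤.gr (-1))
    (hdf : 𝔤.twistedDiff π f = 0) (n : ℕ) :
    𝔤.twistedDiff π ((X.twistedOne π)^[n] f) =
      - (n • 𝔤.br (X.atPoint π) ((X.twistedOne π)^[n - 1] f)) := by
  have hodd : ∀ n, IsOdd ((X.twistedOne π)^[n] f) := fun n =>
    ⟨-1, odd_neg_one, twistedOne_iterate_mem_gr hX hπ.1 hf n⟩
  have hν : IsOdd (X.atPoint π) := ⟨1, odd_one, atPoint_mem_gr hX hπ.1⟩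
  let F : 𝔤.Total →+ 𝔤.Total := AddMonoidHom.mk' (X.twistedOne π) fun x y => by
    simpa only [twistedOne_eq_twistedList] using twistedList_add hX x y
  induction n with
  | zero => simpa using hdf
  | succ n ih =>
    have h := twistedDiff_twistedOne H hd hbr hπ hX (hodd n)
    have hF : X.twistedOne π (𝔤.twistedDiff π ((X.twistedOne π)^[n] f)) =
        - (n • 𝔤.br (X.atPoint π) ((X.twistedOne π)^[n] f)) := by
      rw [ih]
      change F (- (n • _)) = _
      rw [map_neg, map_nsmul]
      change - (n • X.twistedOne π _) = _
      rw [twistedOne_br_atPoint H hd hbr hπ hX hN (hodd _)]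
      cases n with
      | zero => simp
      | succ n => rw [← iterate_succ_apply' (X.twistedOne π), Nat.add_sub_cancel]
    rw [hF, H.br_symm_of_isOdd (hodd n) hν] at h
    rw [iterate_succ_apply', eq_sub_of_add_eq h, Nat.add_sub_cancel, succ_nsmul, neg_add,
      sub_eq_add_neg]

/-- The bracket twisted by `π` of `X_{π,1}^k(f)` and `X_{π,1}^l(g)`, in terms of the bracket twisted
by `X(π)`. -/
theorem br_br_twistedOne_iterate {f g : 𝔤.Total} (hg : g ∈ 𝔤.gr (-1))
    (hdg : 𝔤.twistedDiff π g = 0) (l : ℕ) :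
    𝔤.br f (𝔤.br π ((X.twistedOne π)^[l] g)) =
      - (l • 𝔤.br f (𝔤.br (X.atPoint π) ((X.twistedOne π)^[l - 1] g))) := by
  have h := twistedDiff_twistedOne_iterate H hd hbr hπ hX hN hg hdg l
  rw [twistedDiff, H.diff_eq_zero (twistedOne_iterate_mem_gr hX hπ.1 hg l), zero_add] at h
  rw [h, map_neg, map_nsmul]

theorem br_br_atPoint_twistedOne_iterate_eq_zero {f g : 𝔤.Total} (hf : f ∈ 𝔤.gr (-1))
    (hg : g ∈ 𝔤.gr (-1)) (hdf : 𝔤.twistedDiff π f = 0) (hdg : 𝔤.twistedDiff π g = 0) (k l : ℕ) :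
    𝔤.br ((X.twistedOne π)^[k] f) (𝔤.br (X.atPoint π) ((X.twistedOne π)^[l] g)) = 0 := by
  have hfm := twistedOne_iterate_mem_gr (k := -1) hX hπ.1 hf
  have hgm := twistedOne_iterate_mem_gr (k := -1) hX hπ.1 hg
  have hν := atPoint_mem_gr hX hπ.1
  -- Computing the bracket twisted by `π` of the iterates of orders `k` and `l + 1` from either side
  -- relates the brackets `B(k, l)` in question by `(l + 1) B(k, l) = k B(k - 1, l + 1)`.
  have key : ∀ k l : ℕ,
      (l + 1) • 𝔤.br ((X.twistedOne π)^[k] f) (𝔤.br (X.atPoint π) ((X.twistedOne π)^[l] g)) =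
      k • 𝔤.br ((X.twistedOne π)^[k - 1] f)
        (𝔤.br (X.atPoint π) ((X.twistedOne π)^[l + 1] g)) := by
    intro k l
    have h := H.br_br_antisymm hπ.1 (hfm k) (hgm (l + 1))
    rw [br_br_twistedOne_iterate H hd hbr hπ hX hN hg hdg,
      br_br_twistedOne_iterate H hd hbr hπ hX hN hf hdf,
      H.br_br_antisymm hν (hgm (l + 1)) (hfm (k - 1)), Nat.add_sub_cancel] at h
    simpa using h
  induction k generalizing l with
  | zero =>
    have h := key 0 l
    rw [zero_smul, ← Nat.cast_smul_eq_nsmul 𝕜] at h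
    exact (smul_eq_zero.1 h).resolve_left (by exact_mod_cast Nat.succ_ne_zero l)
  | succ k ih =>
    have h := key (k + 1) l
    rw [Nat.add_sub_cancel, ih, smul_zero, ← Nat.cast_smul_eq_nsmul 𝕜] at h
    exact (smul_eq_zero.1 h).resolve_left (by exact_mod_cast Nat.succ_ne_zero l)

end Convergence

end LInftyDerivation

end GradedBracketComplex

end DeformationTheory

theorem mainTheorem1 {𝕜 : Type*} [RCLike 𝕜] {m : ℕ} {M : Type*} [TopologicalSpace M]
    [ChartedSpace (EuclideanSpace ℝ (Fin m)) M] [IsManifold (𝓡 m) ∞ M] [T2Space M]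
    [SigmaCompactSpace M]
    (𝔤 : DeformationTheory.GradedBracketComplex 𝕜)
    (h𝔤 : DeformationTheory.IsDeformationAlgebra 𝕜 m M 𝔤)
    [∀ n, TopologicalSpace (𝔤.C n)] [∀ n, IsTopologicalAddGroup (𝔤.C n)]
    [∀ n, T2Space (𝔤.C n)]
    (hd : ∀ n, Continuous (𝔤.d n))
    (hbr : ∀ (p q r : ℕ) (h : p + q = r + 1) (x : 𝔤.C p), Continuous (𝔤.bracket p q r h x))
    (X : 𝔤.LInftyDerivation) (π : 𝔤.Total) (hπ : 𝔤.IsMaurerCartan π)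
    (hconv : X.TwistConverges π) (hN : X.StrongNijenhuis π)
    (f g : 𝔤.Total) (hf : f ∈ 𝔤.gr (-1)) (hg : g ∈ 𝔤.gr (-1))
    (hdf : 𝔤.twistedDiff π f = 0) (hdg : 𝔤.twistedDiff π g = 0) (k l : ℕ) :
    𝔤.br ((X.twistedOne π)^[k] f) (𝔤.br π ((X.twistedOne π)^[l] g)) = 0 := by
  have H := h𝔤.hasDerivedBracket
  rw [DeformationTheory.GradedBracketComplex.LInftyDerivation.br_br_twistedOne_iterate H hd hbr hπ
      hconv hN hg hdg,
    DeformationTheory.GradedBracketComplex.LInftyDerivation.br_br_atPoint_twistedOne_iterate_eq_zero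
      H hd hbr hπ hconv hN hf hg hdf hdg, smul_zero, neg_zero]
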